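/- Let $n\ge 1$. A convex body in $\mathbb{R}^n$ is a compact convex set with non-empty interior; it is centered if its barycenter $\frac1{|K|}\int_K x\,dx$ is the origin, where $|\cdot|$ denotes Lebesgue volume. For a centered convex body $K\subseteq\mathbb{R}^n$ put $\|x\|_K=\inf\{t>0 : x\in tK\}$, $$\delta_K(\varepsilon)=\inf\Big\{1-\Big\|\frac{x+y}{2}\Big\|_K : \|x\|_K,\|y\|_K\le 1,\ \|x-y\|_K\ge\varepsilon\Big\}$$ (the modulus of convexity of $K$), and $$\Delta_{KB}(K)=\max_{x\in\mathbb{R}^n}\frac{|(K-x)\cap(x-K)|}{|K|}$$ (the Kövner–Besicovitch measure of symmetry of $K$). **Theorem.** Let $0<r<1$ and $0<\varepsilon<\sqrt2$, and let $K\subseteq\mathbb{R}^n$ be a centered convex body with $\delta_K(\varepsilon)\ge r$. Set $\alpha=1-\exp\left(-\frac{(\sqrt2-\varepsilon)^2}{4}\,n\right)$. Then $$\Delta_{KB}(K)\ \ge\ \alpha\,2^{-n}\left(\frac1{1-r}\right)^n\qquad\text{and}\qquad \frac{|K\cap(-K)|}{|K|}\ \ge\ \frac1{e\sqrt n}\,2^{-n}\left(\frac1{1-\alpha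 r}\right)^n .$$ -/

import Mathlib

open MeasureTheory Set Topology
open scoped Pointwise

/-- A convex body in `ℝⁿ`: a compact convex set with non-empty interior. -/
structure IsConvexBody {n : ℕ} (K : Set (EuclideanSpace ℝ (Fin n))) : Prop where
  convex : Convex ℝ K
  isCompact : IsCompact K
  interior_nonempty : (interior K).Nonempty

/-- The barycenter `b(K) = |K|⁻¹ ∫_K x dx`. A convex body is centered if it is `0`. -/
noncomputable def barycenter {n : ℕ} (K : Set (EuclideanSpace ℝ (Fin n))) :
    EuclideanSpace ℝ (Fin n) :=
  ⨍ x in K, x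

/-- The modulus of convexity `δ_K(ε)`, the infimum of `1 - ‖(x + y) / 2‖_K` over all `x, y` with
`‖x‖_K, ‖y‖_K ≤ 1` and `‖x - y‖_K ≥ ε`, where `‖x‖_K = inf {t > 0 : x ∈ t K}` is `gauge K x`. -/
noncomputable def modulusOfConvexity {n : ℕ} (K : Set (EuclideanSpace ℝ (Fin n))) (ε : ℝ) : ℝ :=
  sInf {d : ℝ | ∃ x y : EuclideanSpace ℝ (Fin n), gauge K x ≤ 1 ∧ gauge K y ≤ 1 ∧
    ε ≤ gauge K (x - y) ∧ d = 1 - gauge K ((1 / 2 : ℝ) • (x + y))}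

/-- The relative volume `|(K - x) ∩ (x - K)| / |K|` of the symmetric intersection of `K` at `x`. -/
noncomputable def symmRatio {n : ℕ} (K : Set (EuclideanSpace ℝ (Fin n)))
    (x : EuclideanSpace ℝ (Fin n)) : ℝ :=
  volume.real ((K - {x}) ∩ ({x} - K)) / volume.real K

/-- The Kövner-Besicovitch measure of symmetry. The supremum is a maximum for convex bodies, see
`IsConvexBody.isGreatest_kovnerBesicovitch`. -/
noncomputable def kovnerBesicovitch {n : ℕ} (K : Set (EuclideanSpace ℝ (Fin n))) : ℝ :=
  sSup (range (symmRatio K))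

theorem mem_symmInter {n : ℕ} {K : Set (EuclideanSpace ℝ (Fin n))}
    {x y : EuclideanSpace ℝ (Fin n)} :
    y ∈ (K - {x}) ∩ ({x} - K) ↔ y + x ∈ K ∧ x - y ∈ K := by
  simp only [mem_inter_iff, Set.mem_sub, mem_singleton_iff, exists_eq_left]
  constructor
  · rintro ⟨⟨a, ha, rfl⟩, ⟨b, hb, h⟩⟩
    refine ⟨by simpa using ha, ?_⟩
    rw [← h]; simpa using hb
  · rintro ⟨h1, h2⟩
    exact ⟨⟨_, h1, by abel⟩, ⟨_, h2, by abel⟩⟩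

theorem IsConvexBody.isGreatest_kovnerBesicovitch {n : ℕ}
    {K : Set (EuclideanSpace ℝ (Fin n))} (hK : IsConvexBody K) :
    IsGreatest (range (symmRatio K)) (kovnerBesicovitch K) := by
  have hKc := hK.isCompact
  have hKne : K.Nonempty := hK.interior_nonempty.mono interior_subset
  set S : EuclideanSpace ℝ (Fin n) → Set (EuclideanSpace ℝ (Fin n)) :=
    fun x => (K - {x}) ∩ ({x} - K) with hS
  have hSc : ∀ x, IsCompact (S x) := fun x => by
    simp only [hS, sub_eq_add_neg]
    exact (hKc.add isCompact_singleton.neg).inter (isCompact_singleton.add hKc.neg)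
  -- upper semicontinuity of the volume of the symmetric intersection
  have husc : UpperSemicontinuous fun x => volume (S x) := by
    intro x₀ c hc
    obtain ⟨U, hSU, hUo, hUc⟩ := (S x₀).exists_isOpen_lt_of_lt c hc
    -- the pairs `(x, z)` with `2x - z ∈ K` and `z - x ∉ U` form a closed set
    have hcl : IsClosed {p : EuclideanSpace ℝ (Fin n) × EuclideanSpace ℝ (Fin n) |
        p.1 + p.1 - p.2 ∈ K ∧ p.2 - p.1 ∉ U} := by
      refine IsClosed.inter (hKc.isClosed.preimage (by fun_prop)) ?_
      exact (hUo.isClosed_compl).preimage (f := fun p : EuclideanSpace ℝ (Fin n) ×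
        EuclideanSpace ℝ (Fin n) => p.2 - p.1) (by fun_prop)
    have hev : ∀ᶠ x in 𝓝 x₀, ∀ z ∈ K,
        (x, z) ∈ {p : EuclideanSpace ℝ (Fin n) × EuclideanSpace ℝ (Fin n) |
          p.1 + p.1 - p.2 ∈ K ∧ p.2 - p.1 ∉ U}ᶜ := by
      refine hKc.eventually_forall_of_forall_eventually fun z hz => ?_
      refine hcl.isOpen_compl.mem_nhds ?_
      rintro ⟨h1, h2⟩
      refine h2 (hSU (mem_symmInter.2 ⟨by simpa using hz, ?_⟩))
      have : x₀ - (z - x₀) = x₀ + x₀ - z := by abel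
      rwa [this]
    filter_upwards [hev] with x hx
    refine lt_of_le_of_lt (measure_mono fun y hy => ?_) hUc
    obtain ⟨h1, h2⟩ := mem_symmInter.1 hy
    by_contra hyU
    refine hx _ h1 ⟨?_, ?_⟩
    · have : x + x - (y + x) = x - y := by abel
      simpa [this] using h2
    · simpa using hyU
  obtain ⟨a, -, ha⟩ := (husc.upperSemicontinuousOn K).exists_isMaxOn hKne hKc
  have hmax : ∀ x, volume (S x) ≤ volume (S a) := by
    intro x
    rcases (S x).eq_empty_or_nonempty with h | ⟨y, hy⟩
    · simp [h]
    · refine ha ?_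
      obtain ⟨h1, h2⟩ := mem_symmInter.1 hy
      have h := hK.convex h1 h2 (a := 1 / 2) (b := 1 / 2) (by norm_num) (by norm_num) (by norm_num)
      have : (1 / 2 : ℝ) • (y + x) + (1 / 2 : ℝ) • (x - y) = x := by module
      rwa [this] at h
  have hg : IsGreatest (range (symmRatio K)) (symmRatio K a) := by
    refine ⟨mem_range_self a, ?_⟩
    rintro _ ⟨x, rfl⟩
    exact div_le_div_of_nonneg_right
      (ENNReal.toReal_mono (hSc a).measure_lt_top.ne (hmax x)) measureReal_nonneg
  have : kovnerBesicovitch K = symmRatio K a := hg.csSup_eq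
  rwa [this]

/-!
The midpoint of two independent uniform points of `K` has density proportional to `symmRatio K`.
Young's inequality with sharp constant, proved by Barthe's transport argument, shows that the two
points are at `K`-distance at least `ε` with probability at least `α`; in that event uniform
convexity puts the midpoint into `(1 - r) • K`, so `α` is at most the supremum of the density times
the volume of `(1 - r) • K`. For the second bound, the gauge of the midpoint has expectation at most
`1 - α * r`. By the Prékopa-Leindler inequality the density is log-concave, so it is at most its
value at `0` times `exp ℓ` for a linear `ℓ`, and `ℓ` has mean zero because `K` is centered. Gibbs'
inequality against `exp (-c * gauge K z)` with `c = n / (1 - α * r)`, together with the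
non-asymptotic Stirling bound, concludes.
-/

section MonotoneTransport

open ProbabilityTheory
open scoped ENNReal

theorem lt_of_monotone_of_hasDerivAt_left_pos {F : ℝ → ℝ} (hF : Monotone F) {d x y : ℝ}
    (hd : 0 < d) (h : HasDerivAt F d x) (hxy : x < y) : F x < F y := by
  refine (hF hxy.le).lt_of_ne fun heq => hd.ne' (IsLocalMax.hasDerivAt_eq_zero (f := F) ?_ h)
  filter_upwards [Iio_mem_nhds hxy] with z hz
  exact (hF (le_of_lt hz)).trans heq.ge

theorem lt_of_monotone_of_hasDerivAt_right_pos {F : ℝ → ℝ} (hF : Monotone F) {d x y : ℝ}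
    (hd : 0 < d) (h : HasDerivAt F d x) (hyx : y < x) : F y < F x := by
  refine (hF hyx.le).lt_of_ne fun heq => hd.ne' (IsLocalMin.hasDerivAt_eq_zero (f := F) ?_ h)
  filter_upwards [Ioi_mem_nhds hyx] with z hz
  exact heq.ge.trans (hF (le_of_lt hz))

theorem cdf_mem_Ioo_of_hasDerivAt_pos {μ : Measure ℝ} {d x : ℝ} (hd : 0 < d)
    (h : HasDerivAt (cdf μ) d x) : cdf μ x ∈ Ioo 0 1 :=
  ⟨(cdf_nonneg μ (x - 1)).trans_lt
      (lt_of_monotone_of_hasDerivAt_right_pos (monotone_cdf μ) hd h (sub_one_lt x)),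
    (lt_of_monotone_of_hasDerivAt_left_pos (monotone_cdf μ) hd h (lt_add_one x)).trans_le
      (cdf_le_one μ (x + 1))⟩

theorem ae_hasDerivAt_cdf_withDensity {f : ℝ → ℝ≥0∞} (hf : Measurable f)
    (h1 : ∫⁻ x, f x = 1) :
    ∀ᵐ x, HasDerivAt (cdf (volume.withDensity f)) (f x).toReal x := by
  have : IsProbabilityMeasure (volume.withDensity f) := ⟨by simp [h1]⟩
  filter_upwards [(cdf (volume.withDensity f)).ae_hasDerivAt, Measure.rnDeriv_withDensity volume hf]
    with x hx hfx
  rwa [measure_cdf, hfx] at hx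

theorem hasStrictDerivAt_cdf_withDensity {ρ : ℝ → ℝ} (hρ : Continuous ρ) (h0 : ∀ x, 0 ≤ ρ x)
    (h1 : ∫⁻ x, ENNReal.ofReal (ρ x) = 1) (x : ℝ) :
    HasStrictDerivAt (cdf (volume.withDensity fun t => ENNReal.ofReal (ρ t))) (ρ x) x := by
  set G := cdf (volume.withDensity fun t => ENNReal.ofReal (ρ t))
  have : IsProbabilityMeasure (volume.withDensity fun t => ENNReal.ofReal (ρ t)) :=
    ⟨by simp [h1]⟩
  have hi : Integrable ρ := ⟨hρ.aestronglyMeasurable, by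
    simp [hasFiniteIntegral_iff_ofReal (Filter.Eventually.of_forall h0), h1]⟩
  have hG (y : ℝ) : G y = ∫ t in Iic y, ρ t := by
    rw [cdf_eq_real, measureReal_def, withDensity_apply _ measurableSet_Iic,
      integral_eq_lintegral_of_nonneg_ae (Filter.Eventually.of_forall h0)
        hρ.aestronglyMeasurable.restrict]
  refine ((intervalIntegral.integral_hasStrictDerivAt_right (a := 0)
    (hρ.intervalIntegrable _ _) (hρ.stronglyMeasurableAtFilter _ _)
    hρ.continuousAt).const_add (G 0)).congr_of_eventuallyEq
      (Filter.Eventually.of_forall fun y => ?_)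
  simp only [hG]
  rw [← intervalIntegral.integral_Iic_sub_Iic hi.integrableOn hi.integrableOn]
  ring

theorem strictMono_cdf_withDensity {ρ : ℝ → ℝ} (hρ : Continuous ρ) (h0 : ∀ x, 0 < ρ x)
    (h1 : ∫⁻ x, ENNReal.ofReal (ρ x) = 1) :
    StrictMono (cdf (volume.withDensity fun t => ENNReal.ofReal (ρ t))) :=
  strictMono_of_deriv_pos fun x => by
    rw [(hasStrictDerivAt_cdf_withDensity hρ (fun x => (h0 x).le) h1 x).hasDerivAt.deriv]
    exact h0 x

theorem exists_cdf_eq_of_continuous {μ : Measure ℝ} (hc : Continuous (cdf μ)) {p : ℝ}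
    (hp : p ∈ Ioo 0 1) : ∃ x, cdf μ x = p := by
  obtain ⟨a, ha⟩ := ((tendsto_cdf_atBot μ).eventually_lt_const hp.1).exists
  obtain ⟨b, hb⟩ := ((tendsto_cdf_atTop μ).eventually_const_lt hp.2).exists
  exact mem_range_of_exists_le_of_exists_ge hc ⟨a, ha.le⟩ ⟨b, hb.le⟩

/-- `T` is a monotone transport of the density `f` to the probability density `ρ`: it is
increasing on a measurable set `D` carrying `f`, and the Monge-Ampère equation
`f = (∫ f) T' ρ(T)` holds at the points of `D`. -/
structure IsMonotoneTransport (f : ℝ → ℝ≥0∞) (ρ T : ℝ → ℝ) (D : Set ℝ) : Prop where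
  measurableSet : MeasurableSet D
  ae_eq_zero : ∀ᵐ x, x ∉ D → f x = 0
  strictMonoOn : StrictMonoOn T D
  differentiableAt : ∀ x ∈ D, DifferentiableAt ℝ T x
  deriv_pos : ∀ x ∈ D, 0 < deriv T x
  eq_mul_deriv : ∀ x ∈ D, f x = (∫⁻ t, f t) * ENNReal.ofReal (deriv T x * ρ (T x))

theorem exists_measurableSet_hasDerivAt_cdf {f : ℝ → ℝ≥0∞} (hf : Measurable f)
    (h1 : ∫⁻ x, f x = 1) :
    ∃ D, MeasurableSet D ∧ (∀ᵐ x, x ∉ D → f x = 0) ∧ ∀ x ∈ D, 0 < (f x).toReal ∧ f x ≠ ∞ ∧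
      HasDerivAt (cdf (volume.withDensity f)) (f x).toReal x := by
  have hN : ∀ᵐ x, HasDerivAt (cdf (volume.withDensity f)) (f x).toReal x ∧ f x < ∞ :=
    (ae_hasDerivAt_cdf_withDensity hf h1).and (ae_lt_top hf (by simp [h1]))
  obtain ⟨N, hNsub, hNm, hN0⟩ := exists_measurable_superset_of_null (ae_iff.1 hN)
  refine ⟨{x | f x ≠ 0} \ N, (hf (measurableSet_singleton 0)).compl.diff hNm, ?_, ?_⟩
  · filter_upwards [measure_eq_zero_iff_ae_notMem.1 hN0] with x hx hxD
    exact of_not_not fun h => hxD ⟨h, hx⟩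
  · rintro x ⟨hx0, hxN⟩
    obtain ⟨hd, hfin⟩ := of_not_not fun h => hxN (hNsub h)
    exact ⟨ENNReal.toReal_pos hx0 hfin.ne, hfin.ne, hd⟩

/-- The transport is the composition of the distribution function of `f` with the quantile
function of `ρ`. -/
theorem exists_isMonotoneTransport_of_lintegral_eq_one {f : ℝ → ℝ≥0∞} (hf : Measurable f)
    (h1 : ∫⁻ x, f x = 1) {ρ : ℝ → ℝ} (hρ : Continuous ρ) (hρ0 : ∀ x, 0 < ρ x)
    (hρ1 : ∫⁻ x, ENNReal.ofReal (ρ x) = 1) : ∃ T D, IsMonotoneTransport f ρ T D := by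
  set F := cdf (volume.withDensity f)
  set G := cdf (volume.withDensity fun t => ENNReal.ofReal (ρ t))
  have hG := hasStrictDerivAt_cdf_withDensity hρ (fun x => (hρ0 x).le) hρ1
  have hGmono : StrictMono G := strictMono_cdf_withDensity hρ hρ0 hρ1
  have hGcont : Continuous G := continuous_iff_continuousAt.2 fun x =>
    (hG x).hasDerivAt.continuousAt
  set Q := Function.invFun G
  have hQG : Function.LeftInverse Q G := Function.leftInverse_invFun hGmono.injective
  obtain ⟨D, hDm, hDf, hD⟩ := exists_measurableSet_hasDerivAt_cdf hf h1
  have hGQ : ∀ x ∈ D, G (Q (F x)) = F x := fun x hx =>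
    Function.invFun_eq (exists_cdf_eq_of_continuous hGcont
      (cdf_mem_Ioo_of_hasDerivAt_pos (hD x hx).1 (hD x hx).2.2))
  have hderiv : ∀ x ∈ D, HasDerivAt (Q ∘ F) ((ρ (Q (F x)))⁻¹ * (f x).toReal) x := fun x hx => by
    have hQ := (hG (Q (F x))).to_local_left_inverse (hρ0 _).ne' (Filter.Eventually.of_forall hQG)
    rw [hGQ x hx] at hQ
    exact hQ.hasDerivAt.comp x (hD x hx).2.2
  refine ⟨Q ∘ F, D, hDm, hDf, fun x hx y hy hxy => ?_,
    fun x hx => (hderiv x hx).differentiableAt, fun x hx => ?_, fun x hx => ?_⟩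
  · rw [← hGmono.lt_iff_lt, Function.comp_apply, Function.comp_apply, hGQ x hx, hGQ y hy]
    exact lt_of_monotone_of_hasDerivAt_left_pos (monotone_cdf _) (hD x hx).1 (hD x hx).2.2 hxy
  · rw [(hderiv x hx).deriv]
    exact mul_pos (inv_pos.2 (hρ0 _)) (hD x hx).1
  · rw [(hderiv x hx).deriv, Function.comp_apply, mul_right_comm, inv_mul_cancel₀ (hρ0 _).ne',
      one_mul, ENNReal.ofReal_toReal (hD x hx).2.1, h1, one_mul]

theorem exists_isMonotoneTransport {f : ℝ → ℝ≥0∞} (hf : Measurable f) (h0 : ∫⁻ x, f x ≠ 0)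
    (ht : ∫⁻ x, f x ≠ ∞) {ρ : ℝ → ℝ} (hρ : Continuous ρ) (hρ0 : ∀ x, 0 < ρ x)
    (hρ1 : ∫⁻ x, ENNReal.ofReal (ρ x) = 1) : ∃ T D, IsMonotoneTransport f ρ T D := by
  have h1 : ∫⁻ x, (∫⁻ t, f t)⁻¹ * f x = 1 := by
    rw [lintegral_const_mul _ hf, ENNReal.inv_mul_cancel h0 ht]
  obtain ⟨T, D, hT⟩ := exists_isMonotoneTransport_of_lintegral_eq_one (hf.const_mul _) h1 hρ hρ0 hρ1
  refine ⟨T, D, hT.measurableSet, hT.ae_eq_zero.mono fun x hx hxD => ?_, hT.strictMonoOn,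
    hT.differentiableAt, hT.deriv_pos, fun x hx => ?_⟩
  · exact (mul_eq_zero.1 (hx hxD)).resolve_left (ENNReal.inv_ne_zero.2 ht)
  · have h := hT.eq_mul_deriv x hx
    rw [h1, one_mul] at h
    rw [← h, ← mul_assoc, ENNReal.mul_inv_cancel h0 ht, one_mul]

/-- The Gaussian probability density `exp (-π x²)` on the line, the target of all transports. -/
noncomputable def gaussDensity (x : ℝ) : ℝ := Real.exp (-Real.pi * x ^ 2)

theorem gaussDensity_pos (x : ℝ) : 0 < gaussDensity x := Real.exp_pos _

theorem continuous_gaussDensity : Continuous gaussDensity := by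
  unfold gaussDensity; fun_prop

theorem lintegral_gaussDensity : ∫⁻ x, ENNReal.ofReal (gaussDensity x) = 1 := by
  unfold gaussDensity
  rw [← ofReal_integral_eq_lintegral_ofReal (integrable_exp_neg_mul_sq Real.pi_pos)
    (Filter.Eventually.of_forall fun x => (Real.exp_pos _).le), integral_gaussian]
  simp [Real.pi_ne_zero]

theorem exists_isMonotoneTransport_gaussDensity {f : ℝ → ℝ≥0∞} (hf : Measurable f)
    (h0 : ∫⁻ x, f x ≠ 0) (ht : ∫⁻ x, f x ≠ ∞) : ∃ T D, IsMonotoneTransport f gaussDensity T D :=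
  exists_isMonotoneTransport hf h0 ht continuous_gaussDensity gaussDensity_pos
    lintegral_gaussDensity

end MonotoneTransport

section SharpYoung

open scoped ENNReal

/-- The exponents of the sharp Young inequality for `∫∫ f(x)^a g(y)^b h(x - y)^c`; they are the
reciprocals of the exponents of the usual formulation. -/
structure YoungExponents (a b c : ℝ) : Prop where
  pos_left : 0 < a
  pos_mid : 0 < b
  pos_right : 0 < c
  lt_one_left : a < 1
  lt_one_mid : b < 1
  lt_one_right : c < 1
  add_eq_two : a + b + c = 2

/-- The contribution of the exponent `t` to the sharp constant in Young's inequality. -/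
noncomputable def youngFactor (t : ℝ) : ℝ := √(1 - t) ^ (1 - t) / √t ^ t

/-- The coordinates of `(√a t, √b u, √c w)` in an orthonormal basis of the plane orthogonal to the
unit vector `(√(1 - a), -√(1 - b), -√(1 - c))`. -/
noncomputable def youngProj (a b c t u w : ℝ) : ℝ × ℝ :=
  ((√(1 - b) * (√a * t) + √(1 - a) * (√b * u)) / √c,
    √(1 - c) * (√(1 - a) * (√a * t) - √(1 - b) * (√b * u)) / √c + c * w)

/-- Minus the Jacobian determinant of `(x, y) ↦ youngProj a b c (T x) (U y) (W (x - y))`, as a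
function of the derivatives of `T`, `U` and `W`. -/
noncomputable def youngJacobian (a b c t u w : ℝ) : ℝ :=
  √(1 - c) * √a * √b * (t * u) + √(1 - b) * √a * √c * (t * w) + √(1 - a) * √b * √c * (u * w)

variable {a b c : ℝ}

theorem youngFactor_pos {t : ℝ} (h0 : 0 < t) (h1 : t < 1) : 0 < youngFactor t := by
  have : 0 < 1 - t := by linarith
  unfold youngFactor
  positivity

theorem YoungExponents.sq_sqrt_add_sq_sqrt (he : YoungExponents a b c) :
    √(1 - a) ^ 2 + √(1 - b) ^ 2 = √c ^ 2 := by
  rw [Real.sq_sqrt (sub_pos.2 he.lt_one_left).le, Real.sq_sqrt (sub_pos.2 he.lt_one_mid).le,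
    Real.sq_sqrt he.pos_right.le]
  linarith [he.add_eq_two]

theorem YoungExponents.youngProj_sq_add_sq (he : YoungExponents a b c) (t u w : ℝ) :
    (youngProj a b c t u w).1 ^ 2 + (youngProj a b c t u w).2 ^ 2 =
      a * t ^ 2 + b * u ^ 2 + c * w ^ 2 -
        (√(1 - a) * (√a * t) - √(1 - b) * (√b * u) - √(1 - c) * (√c * w)) ^ 2 := by
  have hPQ := he.sq_sqrt_add_sq_sqrt
  obtain ⟨ha, hb, hc, -, -, hc1, -⟩ := he
  have hC := Real.sqrt_pos.2 hc
  have hC2 := Real.sq_sqrt hc.le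
  have hS : √(1 - c) ^ 2 = 1 - √c ^ 2 := by rw [Real.sq_sqrt (sub_nonneg.2 hc1.le), hC2]
  have hx : a * t ^ 2 = (√a * t) ^ 2 := by rw [mul_pow, Real.sq_sqrt ha.le]
  have hy : b * u ^ 2 = (√b * u) ^ 2 := by rw [mul_pow, Real.sq_sqrt hb.le]
  rw [hx, hy, youngProj]
  generalize √a * t = x
  generalize √b * u = y
  generalize √(1 - c) = s at *
  generalize √c = C at *
  subst hC2
  have hfst : ((√(1 - b) * x + √(1 - a) * y) / C) ^ 2 =
      x ^ 2 + y ^ 2 - (√(1 - a) * x - √(1 - b) * y) ^ 2 / C ^ 2 := by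
    field_simp
    linear_combination (x ^ 2 + y ^ 2) * hPQ
  simp only [hfst]
  generalize √(1 - a) * x - √(1 - b) * y = m
  field_simp
  linear_combination (m ^ 2 + C ^ 4 * w ^ 2) * hS

theorem YoungExponents.gaussDensity_rpow_mul_le (he : YoungExponents a b c) (t u w : ℝ) :
    gaussDensity t ^ a * gaussDensity u ^ b * gaussDensity w ^ c ≤
      gaussDensity (youngProj a b c t u w).1 * gaussDensity (youngProj a b c t u w).2 := by
  simp only [gaussDensity, ← Real.exp_mul, ← Real.exp_add]
  refine Real.exp_le_exp.2 ?_
  have hle : (youngProj a b c t u w).1 ^ 2 + (youngProj a b c t u w).2 ^ 2 ≤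
      a * t ^ 2 + b * u ^ 2 + c * w ^ 2 := by
    rw [he.youngProj_sq_add_sq]
    exact sub_le_self _ (sq_nonneg _)
  linear_combination Real.pi * hle

theorem YoungExponents.rpow_eq_mul (he : YoungExponents a b c) {x : ℝ} (hx : 0 < x) :
    x ^ a = x ^ (1 - c) * x ^ (1 - b) ∧ x ^ b = x ^ (1 - c) * x ^ (1 - a) ∧
      x ^ c = x ^ (1 - b) * x ^ (1 - a) := by
  simp only [← Real.rpow_add hx]
  refine ⟨?_, ?_, ?_⟩ <;> congr 1 <;> linarith [he.add_eq_two]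

theorem YoungExponents.geom_mean_eq_div_youngFactor (he : YoungExponents a b c) {t u w : ℝ}
    (ht : 0 < t) (hu : 0 < u) (hw : 0 < w) :
    ((√a * t) * (√b * u) / √(1 - c)) ^ (1 - c) * ((√a * t) * (√c * w) / √(1 - b)) ^ (1 - b) *
        ((√b * u) * (√c * w) / √(1 - a)) ^ (1 - a) =
      t ^ a * u ^ b * w ^ c / (youngFactor a * youngFactor b * youngFactor c) := by
  have hA := Real.sqrt_pos.2 he.pos_left
  have hB := Real.sqrt_pos.2 he.pos_mid
  have hC := Real.sqrt_pos.2 he.pos_right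
  have ha1 := sub_pos.2 he.lt_one_left
  have hb1 := sub_pos.2 he.lt_one_mid
  have hc1 := sub_pos.2 he.lt_one_right
  simp only [youngFactor, (he.rpow_eq_mul ht).1, (he.rpow_eq_mul hu).2.1, (he.rpow_eq_mul hw).2.2,
    (he.rpow_eq_mul hA).1, (he.rpow_eq_mul hB).2.1, (he.rpow_eq_mul hC).2.2]
  rw [Real.div_rpow (by positivity) (by positivity),
    Real.div_rpow (by positivity) (by positivity),
    Real.div_rpow (by positivity) (by positivity)]
  simp only [Real.mul_rpow (mul_pos hA ht).le (mul_pos hB hu).le,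
    Real.mul_rpow (mul_pos hA ht).le (mul_pos hC hw).le,
    Real.mul_rpow (mul_pos hB hu).le (mul_pos hC hw).le, Real.mul_rpow hA.le ht.le,
    Real.mul_rpow hB.le hu.le, Real.mul_rpow hC.le hw.le]
  field_simp

theorem YoungExponents.rpow_mul_le_youngJacobian (he : YoungExponents a b c) {t u w : ℝ}
    (ht : 0 < t) (hu : 0 < u) (hw : 0 < w) :
    t ^ a * u ^ b * w ^ c ≤
      youngFactor a * youngFactor b * youngFactor c * youngJacobian a b c t u w := by
  have hFa := youngFactor_pos he.pos_left he.lt_one_left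
  have hFb := youngFactor_pos he.pos_mid he.lt_one_mid
  have hFc := youngFactor_pos he.pos_right he.lt_one_right
  have hamgm := Real.geom_mean_le_arith_mean3_weighted (sub_pos.2 he.lt_one_right).le
    (sub_pos.2 he.lt_one_mid).le (sub_pos.2 he.lt_one_left).le
    (p₁ := (√a * t) * (√b * u) / √(1 - c)) (p₂ := (√a * t) * (√c * w) / √(1 - b))
    (p₃ := (√b * u) * (√c * w) / √(1 - a)) (by positivity) (by positivity) (by positivity)
    (by linarith [he.add_eq_two])
  have hmean : (1 - c) * ((√a * t) * (√b * u) / √(1 - c)) +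
      (1 - b) * ((√a * t) * (√c * w) / √(1 - b)) + (1 - a) * ((√b * u) * (√c * w) / √(1 - a)) =
      youngJacobian a b c t u w := by
    simp only [mul_div_left_comm (1 - (_ : ℝ)), Real.div_sqrt, youngJacobian]
    ring
  rwa [hmean, he.geom_mean_eq_div_youngFactor ht hu hw, div_le_iff₀' (by positivity)] at hamgm

/-- The pairs `(x, y) ∈ A × B` with `x - y ∈ D`, that is, the set whose measure Young's inequality
bounds when applied to indicator functions. -/
def subTriple {E : Type*} [Sub E] (A B D : Set E) : Set (E × E) :=
  {p | p.1 ∈ A ∧ p.2 ∈ B ∧ p.1 - p.2 ∈ D}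

theorem measurableSet_subTriple {E : Type*} [MeasurableSpace E] [Sub E] [MeasurableSub₂ E]
    {A B D : Set E} (hA : MeasurableSet A) (hB : MeasurableSet B) (hD : MeasurableSet D) :
    MeasurableSet (subTriple A B D) :=
  (measurable_fst hA).inter ((measurable_snd hB).inter ((measurable_fst.sub measurable_snd) hD))

/-- Barthe's transport of the integrand of Young's inequality to a planar Gaussian. -/
noncomputable def youngMap (a b c : ℝ) (T U W : ℝ → ℝ) (p : ℝ × ℝ) : ℝ × ℝ :=
  youngProj a b c (T p.1) (U p.2) (W (p.1 - p.2))

theorem YoungExponents.injOn_youngMap (he : YoungExponents a b c) {T U W : ℝ → ℝ} {A B D : Set ℝ}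
    (hT : StrictMonoOn T A) (hU : StrictMonoOn U B) (hW : StrictMonoOn W D) :
    InjOn (youngMap a b c T U W) (subTriple A B D) := by
  have ha := Real.sqrt_pos.2 he.pos_left
  have hb := Real.sqrt_pos.2 he.pos_mid
  have hc := Real.sqrt_pos.2 he.pos_right
  have ha1 := Real.sqrt_pos.2 (sub_pos.2 he.lt_one_left)
  have hb1 := Real.sqrt_pos.2 (sub_pos.2 he.lt_one_mid)
  have hc1 := Real.sqrt_pos.2 (sub_pos.2 he.lt_one_right)
  have hfst {p p'} (h : youngMap a b c T U W p = youngMap a b c T U W p') :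
      √(1 - b) * (√a * T p.1) + √(1 - a) * (√b * U p.2) =
        √(1 - b) * (√a * T p'.1) + √(1 - a) * (√b * U p'.2) :=
    (div_left_inj' hc.ne').1 (congrArg Prod.fst h)
  have hne : ∀ p ∈ subTriple A B D, ∀ p' ∈ subTriple A B D, p.1 < p'.1 →
      youngMap a b c T U W p ≠ youngMap a b c T U W p' := fun p hp p' hp' hlt h => by
    have hTlt : √a * T p.1 < √a * T p'.1 := by gcongr; exact hT hp.1 hp'.1 hlt
    have hUlt : √b * U p'.2 < √b * U p.2 :=
      lt_of_mul_lt_mul_left (by linarith [hfst h, mul_lt_mul_of_pos_left hTlt hb1]) ha1.le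
    have hylt : p'.2 < p.2 :=
      (hU.lt_iff_lt hp'.2.1 hp.2.1).1 (lt_of_mul_lt_mul_left hUlt hb.le)
    have hWlt : W (p.1 - p.2) < W (p'.1 - p'.2) := hW hp.2.2 hp'.2.2 (by linarith)
    refine (ne_of_lt ?_ : (youngMap a b c T U W p).2 ≠ _) (congrArg Prod.snd h)
    have := he.pos_right
    simp only [youngMap, youngProj]
    gcongr
  intro p hp p' hp' h
  rcases lt_trichotomy p.1 p'.1 with hlt | heq | hlt
  · exact absurd h (hne p hp p' hp' hlt)
  · have hU' : √(1 - a) * (√b * U p.2) = √(1 - a) * (√b * U p'.2) := by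
      have := hfst h
      rwa [heq, add_right_inj] at this
    exact Prod.ext heq (hU.injOn hp.2.1 hp'.2.1
      (mul_left_cancel₀ hb.ne' (mul_left_cancel₀ ha1.ne' hU')))
  · exact absurd h.symm (hne p' hp' p hp hlt)

theorem YoungExponents.exists_hasFDerivAt_youngMap (he : YoungExponents a b c) {T U W : ℝ → ℝ}
    {p : ℝ × ℝ} (hT : DifferentiableAt ℝ T p.1) (hU : DifferentiableAt ℝ U p.2)
    (hW : DifferentiableAt ℝ W (p.1 - p.2)) :
    ∃ L : ℝ × ℝ →L[ℝ] ℝ × ℝ, HasFDerivAt (youngMap a b c T U W) L p ∧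
      L.det = -youngJacobian a b c (deriv T p.1) (deriv U p.2) (deriv W (p.1 - p.2)) := by
  set t := deriv T p.1
  set u := deriv U p.2
  set w := deriv W (p.1 - p.2)
  set M : Matrix (Fin 2) (Fin 2) ℝ :=
    !![√(1 - b) * √a * t / √c, √(1 - a) * √b * u / √c;
      √(1 - c) * √(1 - a) * √a * t / √c + c * w, -(√(1 - c) * √(1 - b) * √b * u / √c) - c * w]
  refine ⟨LinearMap.toContinuousLinearMap
    (Matrix.toLin (Module.Basis.finTwoProd ℝ) (Module.Basis.finTwoProd ℝ) M), ?_, ?_⟩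
  · have dT := hT.hasDerivAt.comp_hasFDerivAt p (hasFDerivAt_fst (𝕜 := ℝ))
    have dU := hU.hasDerivAt.comp_hasFDerivAt p (hasFDerivAt_snd (𝕜 := ℝ))
    have dW := hW.hasDerivAt.comp_hasFDerivAt p
      ((hasFDerivAt_fst (𝕜 := ℝ) (p := p)).sub (hasFDerivAt_snd (𝕜 := ℝ)))
    have dFst := (((dT.const_mul √a).const_mul √(1 - b)).add
      ((dU.const_mul √b).const_mul √(1 - a))).mul_const (√c)⁻¹
    have dSnd := (((((dT.const_mul √a).const_mul √(1 - a)).sub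
      ((dU.const_mul √b).const_mul √(1 - b))).const_mul √(1 - c)).mul_const (√c)⁻¹).add
        (dW.const_mul c)
    refine (dFst.prodMk dSnd).congr_fderiv ?_
    rw [Matrix.toLin_finTwoProd_toContinuousLinearMap]
    refine ContinuousLinearMap.ext fun v => ?_
    simp only [ContinuousLinearMap.prod_apply, add_apply,
      sub_apply, smul_apply, smul_eq_mul,
      ContinuousLinearMap.coe_fst', ContinuousLinearMap.coe_snd', Prod.mk.injEq]
    constructor <;> ring
  · rw [ContinuousLinearMap.det, LinearMap.coe_toContinuousLinearMap, LinearMap.det_toLin,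
      Matrix.det_fin_two_of, youngJacobian]
    have hc := Real.sqrt_pos.2 he.pos_right
    have hc2 := Real.sq_sqrt he.pos_right.le
    have hab : √(1 - a) ^ 2 + √(1 - b) ^ 2 = √c ^ 2 := he.sq_sqrt_add_sq_sqrt
    generalize √(1 - c) = s
    generalize √c = C at *
    subst hc2
    field_simp
    linear_combination (-(s * √a * √b * t * u)) * hab

theorem mul_ofReal_rpow (m : ℝ≥0∞) {x e : ℝ} (hx : 0 ≤ x) (he : 0 ≤ e) :
    (m * ENNReal.ofReal x) ^ e = m ^ e * ENNReal.ofReal (x ^ e) := by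
  rw [ENNReal.mul_rpow_of_nonneg _ _ he, ENNReal.ofReal_rpow_of_nonneg hx he]

theorem YoungExponents.transport_rpow_le (he : YoungExponents a b c) (T U W : ℝ → ℝ) (p : ℝ × ℝ)
    {t u w : ℝ} (ht : 0 < t) (hu : 0 < u) (hw : 0 < w) :
    (t * gaussDensity (T p.1)) ^ a * (u * gaussDensity (U p.2)) ^ b *
        (w * gaussDensity (W (p.1 - p.2))) ^ c ≤
      youngFactor a * youngFactor b * youngFactor c * (youngJacobian a b c t u w *
        (gaussDensity (youngMap a b c T U W p).1 * gaussDensity (youngMap a b c T U W p).2)) := by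
  have hJ := he.rpow_mul_le_youngJacobian ht hu hw
  have hG := he.gaussDensity_rpow_mul_le (T p.1) (U p.2) (W (p.1 - p.2))
  have hgT := gaussDensity_pos (T p.1)
  have hgU := gaussDensity_pos (U p.2)
  have hgW := gaussDensity_pos (W (p.1 - p.2))
  rw [Real.mul_rpow ht.le hgT.le, Real.mul_rpow hu.le hgU.le, Real.mul_rpow hw.le hgW.le]
  calc _ = t ^ a * u ^ b * w ^ c * (gaussDensity (T p.1) ^ a * gaussDensity (U p.2) ^ b *
        gaussDensity (W (p.1 - p.2)) ^ c) := by ring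
    _ ≤ _ := mul_le_mul hJ hG (by positivity) (hJ.trans' (by positivity))
    _ = _ := by rw [youngMap]; ring

theorem YoungExponents.rpow_mul_rpow_mul_rpow_le (he : YoungExponents a b c)
    {f g h : ℝ → ℝ≥0∞} {T U W : ℝ → ℝ} {A B D : Set ℝ}
    (hT : IsMonotoneTransport f gaussDensity T A) (hU : IsMonotoneTransport g gaussDensity U B)
    (hW : IsMonotoneTransport h gaussDensity W D) {p : ℝ × ℝ} (hp : p ∈ subTriple A B D) :
    f p.1 ^ a * g p.2 ^ b * h (p.1 - p.2) ^ c ≤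
      ENNReal.ofReal (youngFactor a * youngFactor b * youngFactor c) *
        ((∫⁻ x, f x) ^ a * (∫⁻ x, g x) ^ b * (∫⁻ x, h x) ^ c) *
        (ENNReal.ofReal
            (youngJacobian a b c (deriv T p.1) (deriv U p.2) (deriv W (p.1 - p.2))) *
          (ENNReal.ofReal (gaussDensity (youngMap a b c T U W p).1) *
            ENNReal.ofReal (gaussDensity (youngMap a b c T U W p).2))) := by
  have hFa := youngFactor_pos he.pos_left he.lt_one_left
  have hFb := youngFactor_pos he.pos_mid he.lt_one_mid
  have hFc := youngFactor_pos he.pos_right he.lt_one_right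
  have ht := hT.deriv_pos _ hp.1
  have hu := hU.deriv_pos _ hp.2.1
  have hw := hW.deriv_pos _ hp.2.2
  have hgT := gaussDensity_pos (T p.1)
  have hgU := gaussDensity_pos (U p.2)
  have hgW := gaussDensity_pos (W (p.1 - p.2))
  have hΦ := gaussDensity_pos (youngMap a b c T U W p).1
  rw [hT.eq_mul_deriv _ hp.1, hU.eq_mul_deriv _ hp.2.1, hW.eq_mul_deriv _ hp.2.2]
  generalize deriv T p.1 = t at *
  generalize deriv U p.2 = u at *
  generalize deriv W (p.1 - p.2) = w at *
  have hJ0 : 0 ≤ youngJacobian a b c t u w := by unfold youngJacobian; positivity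
  rw [mul_ofReal_rpow _ (by positivity) he.pos_left.le,
    mul_ofReal_rpow _ (by positivity) he.pos_mid.le,
    mul_ofReal_rpow _ (by positivity) he.pos_right.le, ← ENNReal.ofReal_mul hΦ.le,
    ← ENNReal.ofReal_mul hJ0]
  set m := (∫⁻ x, f x) ^ a * (∫⁻ x, g x) ^ b * (∫⁻ x, h x) ^ c with hm
  calc _ = m * ENNReal.ofReal ((t * gaussDensity (T p.1)) ^ a * (u * gaussDensity (U p.2)) ^ b *
        (w * gaussDensity (W (p.1 - p.2))) ^ c) := by
        rw [ENNReal.ofReal_mul (by positivity), ENNReal.ofReal_mul (by positivity), hm]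
        ring
    _ ≤ m * ENNReal.ofReal _ :=
        mul_le_mul' le_rfl (ENNReal.ofReal_le_ofReal (he.transport_rpow_le T U W p ht hu hw))
    _ = _ := by rw [ENNReal.ofReal_mul (by positivity)]; ring

theorem lintegral_prod_gaussDensity :
    ∫⁻ z : ℝ × ℝ, ENNReal.ofReal (gaussDensity z.1) * ENNReal.ofReal (gaussDensity z.2) = 1 := by
  have hm := continuous_gaussDensity.measurable.ennreal_ofReal
  rw [Measure.volume_eq_prod, lintegral_prod_mul hm.aemeasurable hm.aemeasurable,
    lintegral_gaussDensity, one_mul]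

theorem YoungExponents.lintegral_eq_setLIntegral_subTriple (he : YoungExponents a b c)
    {f g h : ℝ → ℝ≥0∞} {ρ σ τ T U W : ℝ → ℝ} {A B D : Set ℝ} (hT : IsMonotoneTransport f ρ T A)
    (hU : IsMonotoneTransport g σ U B) (hW : IsMonotoneTransport h τ W D) :
    ∫⁻ p : ℝ × ℝ, f p.1 ^ a * g p.2 ^ b * h (p.1 - p.2) ^ c =
      ∫⁻ p in subTriple A B D, f p.1 ^ a * g p.2 ^ b * h (p.1 - p.2) ^ c := by
  rw [← lintegral_indicator
    (measurableSet_subTriple hT.measurableSet hU.measurableSet hW.measurableSet)]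
  refine lintegral_congr_ae ?_
  filter_upwards [Measure.quasiMeasurePreserving_fst.ae hT.ae_eq_zero,
    Measure.quasiMeasurePreserving_snd.ae hU.ae_eq_zero,
    (quasiMeasurePreserving_sub volume volume).ae hW.ae_eq_zero] with p hf hg hh
  by_cases hp : p ∈ subTriple A B D
  · rw [indicator_of_mem hp]
  rw [indicator_of_notMem hp]
  simp only [subTriple, mem_ofPred_eq, not_and_or] at hp
  rcases hp with hp | hp | hp
  · simp [hf hp, he.pos_left]
  · simp [hg hp, he.pos_mid]
  · simp [hh hp, he.pos_right]

theorem YoungExponents.lintegral_le_of_isMonotoneTransport (he : YoungExponents a b c)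
    {f g h : ℝ → ℝ≥0∞} {T U W : ℝ → ℝ} {A B D : Set ℝ}
    (hT : IsMonotoneTransport f gaussDensity T A) (hU : IsMonotoneTransport g gaussDensity U B)
    (hW : IsMonotoneTransport h gaussDensity W D) :
    ∫⁻ p : ℝ × ℝ, f p.1 ^ a * g p.2 ^ b * h (p.1 - p.2) ^ c ≤
      ENNReal.ofReal (youngFactor a * youngFactor b * youngFactor c) *
        ((∫⁻ x, f x) ^ a * (∫⁻ x, g x) ^ b * (∫⁻ x, h x) ^ c) := by
  set S := subTriple A B D
  have hS : MeasurableSet S :=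
    measurableSet_subTriple hT.measurableSet hU.measurableSet hW.measurableSet
  have hfderiv : ∀ p ∈ S, ∃ L : ℝ × ℝ →L[ℝ] ℝ × ℝ, HasFDerivAt (youngMap a b c T U W) L p ∧
      L.det = -youngJacobian a b c (deriv T p.1) (deriv U p.2) (deriv W (p.1 - p.2)) :=
    fun p hp => he.exists_hasFDerivAt_youngMap (hT.differentiableAt _ hp.1)
      (hU.differentiableAt _ hp.2.1) (hW.differentiableAt _ hp.2.2)
  choose! L hL hdet using hfderiv
  set Φ := youngMap a b c T U W
  have hm := continuous_gaussDensity.measurable.ennreal_ofReal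
  set G : ℝ × ℝ → ℝ≥0∞ := fun z =>
    ENNReal.ofReal (gaussDensity z.1) * ENNReal.ofReal (gaussDensity z.2)
  have hGm : Measurable G := (hm.comp measurable_fst).mul (hm.comp measurable_snd)
  set C := ENNReal.ofReal (youngFactor a * youngFactor b * youngFactor c) *
    ((∫⁻ x, f x) ^ a * (∫⁻ x, g x) ^ b * (∫⁻ x, h x) ^ c)
  have hpt : ∀ p ∈ S, f p.1 ^ a * g p.2 ^ b * h (p.1 - p.2) ^ c ≤
      ENNReal.ofReal |(L p).det| * (C * G (Φ p)) := fun p hp => by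
    rw [hdet p hp, abs_neg, mul_left_comm]
    refine (he.rpow_mul_rpow_mul_rpow_le hT hU hW hp).trans ?_
    gcongr
    exact le_abs_self _
  calc ∫⁻ p : ℝ × ℝ, f p.1 ^ a * g p.2 ^ b * h (p.1 - p.2) ^ c
      = ∫⁻ p in S, f p.1 ^ a * g p.2 ^ b * h (p.1 - p.2) ^ c :=
        he.lintegral_eq_setLIntegral_subTriple hT hU hW
    _ ≤ ∫⁻ p in S, ENNReal.ofReal |(L p).det| * (C * G (Φ p)) := setLIntegral_mono' hS hpt
    _ = ∫⁻ z in Φ '' S, C * G z :=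
        (lintegral_image_eq_lintegral_abs_det_fderiv_mul volume hS
          (fun p hp => (hL p hp).hasFDerivWithinAt)
          (he.injOn_youngMap hT.strictMonoOn hU.strictMonoOn hW.strictMonoOn)
          fun z => C * G z).symm
    _ ≤ ∫⁻ z, C * G z := setLIntegral_le_lintegral _ _
    _ = C := by rw [lintegral_const_mul _ hGm, lintegral_prod_gaussDensity, mul_one]

end SharpYoung

section YoungTensor

open scoped ENNReal

/-- Young's convolution inequality on `E` with exponents `a`, `b`, `c` and constant `C`, tested
against a third function and written with powers inside the integrals instead of `Lᵖ` norms. -/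
def HasYoungBound (E : Type*) [MeasureSpace E] [Sub E] (a b c : ℝ) (C : ℝ≥0∞) : Prop :=
  ∀ ⦃f g h : E → ℝ≥0∞⦄, Measurable f → Measurable g → Measurable h →
    ∫⁻ p : E × E, f p.1 ^ a * g p.2 ^ b * h (p.1 - p.2) ^ c ∂(volume.prod volume) ≤
      C * ((∫⁻ x, f x) ^ a * (∫⁻ x, g x) ^ b * (∫⁻ x, h x) ^ c)

variable {a b c : ℝ}

theorem YoungExponents.lintegral_eq_zero (he : YoungExponents a b c) {f g h : ℝ → ℝ≥0∞}
    (hf : Measurable f) (hg : Measurable g) (hh : Measurable h)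
    (h0 : ∫⁻ x, f x = 0 ∨ ∫⁻ x, g x = 0 ∨ ∫⁻ x, h x = 0) :
    ∫⁻ p : ℝ × ℝ, f p.1 ^ a * g p.2 ^ b * h (p.1 - p.2) ^ c = 0 := by
  refine lintegral_eq_zero_of_ae_eq_zero ?_
  rw [lintegral_eq_zero_iff hf, lintegral_eq_zero_iff hg, lintegral_eq_zero_iff hh] at h0
  rcases h0 with h0 | h0 | h0
  · filter_upwards [Measure.quasiMeasurePreserving_fst.ae h0] with p hp
    simp [hp, he.pos_left]
  · filter_upwards [Measure.quasiMeasurePreserving_snd.ae h0] with p hp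
    simp [hp, he.pos_mid]
  · filter_upwards [(quasiMeasurePreserving_sub volume volume).ae h0] with p hp
    simp [hp, he.pos_right]

theorem rpow_mul_rpow_mul_rpow_eq_top {x y z : ℝ≥0∞} (ha : 0 < a) (hb : 0 < b)
    (hc : 0 < c) (hx : x ≠ 0) (hy : y ≠ 0) (hz : z ≠ 0) (htop : x = ∞ ∨ y = ∞ ∨ z = ∞) :
    x ^ a * y ^ b * z ^ c = ∞ := by
  have hxa : x ^ a ≠ 0 := by simp [hx, ha.le]
  have hyb : y ^ b ≠ 0 := by simp [hy, hb.le]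
  have hzc : z ^ c ≠ 0 := by simp [hz, hc.le]
  rcases htop with rfl | rfl | rfl
  · rw [ENNReal.top_rpow_of_pos ha, ENNReal.top_mul hyb, ENNReal.top_mul hzc]
  · rw [ENNReal.top_rpow_of_pos hb, ENNReal.mul_top hxa, ENNReal.top_mul hzc]
  · rw [ENNReal.top_rpow_of_pos hc, ENNReal.mul_top (mul_ne_zero hxa hyb)]

theorem YoungExponents.hasYoungBound_real (he : YoungExponents a b c) :
    HasYoungBound ℝ a b c
      (ENNReal.ofReal (youngFactor a * youngFactor b * youngFactor c)) := by
  intro f g h hf hg hh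
  by_cases h0 : ∫⁻ x, f x = 0 ∨ ∫⁻ x, g x = 0 ∨ ∫⁻ x, h x = 0
  · exact (he.lintegral_eq_zero hf hg hh h0).trans_le zero_le
  push Not at h0
  obtain ⟨hf0, hg0, hh0⟩ := h0
  by_cases htop : ∫⁻ x, f x = ∞ ∨ ∫⁻ x, g x = ∞ ∨ ∫⁻ x, h x = ∞
  · have hC : 0 < youngFactor a * youngFactor b * youngFactor c :=
      mul_pos (mul_pos (youngFactor_pos he.pos_left he.lt_one_left)
        (youngFactor_pos he.pos_mid he.lt_one_mid)) (youngFactor_pos he.pos_right he.lt_one_right)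
    rw [rpow_mul_rpow_mul_rpow_eq_top he.pos_left he.pos_mid he.pos_right hf0 hg0 hh0 htop,
      ENNReal.mul_top (ENNReal.ofReal_pos.2 hC).ne']
    exact le_top
  push Not at htop
  obtain ⟨T, A, hT⟩ := exists_isMonotoneTransport_gaussDensity hf hf0 htop.1
  obtain ⟨U, B, hU⟩ := exists_isMonotoneTransport_gaussDensity hg hg0 htop.2.1
  obtain ⟨W, D, hW⟩ := exists_isMonotoneTransport_gaussDensity hh hh0 htop.2.2
  exact he.lintegral_le_of_isMonotoneTransport hT hU hW

theorem lintegral_prod_prod_prod_comm {E F : Type*} [MeasureSpace E] [MeasureSpace F]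
    [SFinite (volume : Measure E)] [SFinite (volume : Measure F)]
    {u : (E × F) × (E × F) → ℝ≥0∞} (hu : Measurable u) :
    ∫⁻ p, u p ∂((volume : Measure (E × F)).prod volume) =
      ∫⁻ p : E × E, ∫⁻ q : F × F, u ((p.1, q.1), (p.2, q.2)) ∂(volume.prod volume)
        ∂(volume.prod volume) := by
  calc ∫⁻ p, u p ∂((volume : Measure (E × F)).prod volume)
      = ∫⁻ x : E, ∫⁻ s : F, ∫⁻ y : E, ∫⁻ t : F, u ((x, s), (y, t)) := by
        rw [lintegral_prod _ hu.aemeasurable, Measure.volume_eq_prod,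
          lintegral_prod _ hu.lintegral_prod_right'.aemeasurable]
        exact lintegral_congr fun x => lintegral_congr fun s =>
          lintegral_prod _ (hu.comp measurable_prodMk_left).aemeasurable
    _ = ∫⁻ x : E, ∫⁻ y : E, ∫⁻ s : F, ∫⁻ t : F, u ((x, s), (y, t)) :=
        lintegral_congr fun x => lintegral_lintegral_swap (Measurable.lintegral_prod_right'
          (f := fun q : (F × E) × F => u ((x, q.1.1), (q.1.2, q.2))) (by fun_prop)).aemeasurable
    _ = ∫⁻ x : E, ∫⁻ y : E, ∫⁻ q : F × F, u ((x, q.1), (y, q.2)) ∂(volume.prod volume) :=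
        lintegral_congr fun x => lintegral_congr fun y =>
          (lintegral_prod (fun q : F × F => u ((x, q.1), (y, q.2))) (by fun_prop)).symm
    _ = _ := (lintegral_prod _ (Measurable.lintegral_prod_right'
          (f := fun r : (E × E) × (F × F) => u ((r.1.1, r.2.1), (r.1.2, r.2.2)))
          (by fun_prop)).aemeasurable).symm

section Tensor

variable {E F : Type*} [MeasureSpace E] [MeasureSpace F] [Sub E] [Sub F] {C D : ℝ≥0∞}

theorem HasYoungBound.of_measurePreserving [SFinite (volume : Measure E)]
    [SFinite (volume : Measure F)] (hE : HasYoungBound E a b c C) {e : E → F}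
    (he : MeasurePreserving e) (hemb : MeasurableEmbedding e)
    (hsub : ∀ x y, e (x - y) = e x - e y) :
    HasYoungBound F a b c C := by
  intro f g h hf hg hh
  rw [← (he.prod he).lintegral_comp_emb (hemb.prodMap hemb), ← he.lintegral_comp hf,
    ← he.lintegral_comp hg, ← he.lintegral_comp hh]
  simp only [Prod.map_fst, Prod.map_snd, ← hsub]
  exact hE (hf.comp he.measurable) (hg.comp he.measurable) (hh.comp he.measurable)

theorem HasYoungBound.prod [SFinite (volume : Measure E)] [SFinite (volume : Measure F)]
    [MeasurableSub₂ E] [MeasurableSub₂ F]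
    (hE : HasYoungBound E a b c C) (hF : HasYoungBound F a b c D) (hD : D ≠ ∞) :
    HasYoungBound (E × F) a b c (C * D) := by
  intro f g h hf hg hh
  have hslice : ∀ {φ : E × F → ℝ≥0∞}, Measurable φ →
      Measurable (fun x => ∫⁻ s, φ (x, s)) ∧ ∫⁻ z, φ z = ∫⁻ x, ∫⁻ s, φ (x, s) := fun hφ =>
    ⟨hφ.lintegral_prod_right', lintegral_prod _ hφ.aemeasurable⟩
  have hsub : Measurable fun p : (E × F) × (E × F) => p.1 - p.2 := by
    change Measurable fun p : (E × F) × (E × F) => (p.1.1 - p.2.1, p.1.2 - p.2.2)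
    fun_prop
  calc ∫⁻ p : (E × F) × (E × F), f p.1 ^ a * g p.2 ^ b * h (p.1 - p.2) ^ c ∂(volume.prod volume)
      = ∫⁻ p : E × E, ∫⁻ q : F × F,
          f (p.1, q.1) ^ a * g (p.2, q.2) ^ b * h (p.1 - p.2, q.1 - q.2) ^ c ∂(volume.prod volume)
            ∂(volume.prod volume) :=
        lintegral_prod_prod_prod_comm (((hf.comp measurable_fst).pow_const a |>.mul
          ((hg.comp measurable_snd).pow_const b)).mul
          ((hh.comp hsub).pow_const c))
    _ ≤ ∫⁻ p : E × E, D * ((∫⁻ s, f (p.1, s)) ^ a * (∫⁻ s, g (p.2, s)) ^ b *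
          (∫⁻ s, h (p.1 - p.2, s)) ^ c) ∂(volume.prod volume) :=
        lintegral_mono fun p => hF (hf.comp measurable_prodMk_left)
          (hg.comp measurable_prodMk_left) (hh.comp measurable_prodMk_left)
    _ ≤ D * (C * ((∫⁻ z, f z) ^ a * (∫⁻ z, g z) ^ b * (∫⁻ z, h z) ^ c)) := by
        rw [lintegral_const_mul' _ _ hD, (hslice hf).2, (hslice hg).2, (hslice hh).2]
        exact mul_le_mul' le_rfl (hE (hslice hf).1 (hslice hg).1 (hslice hh).1)
    _ = C * D * _ := by ring

theorem HasYoungBound.volume_subTriple_le [MeasurableSub₂ E] (hE : HasYoungBound E a b c C)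
    (ha : 0 < a) (hb : 0 < b) (hc : 0 < c) {A B S : Set E} (hA : MeasurableSet A)
    (hB : MeasurableSet B) (hS : MeasurableSet S) :
    ((volume : Measure E).prod volume) (subTriple A B S) ≤
      C * (volume A ^ a * volume B ^ b * volume S ^ c) := by
  have hind : ∀ p : E × E, (subTriple A B S).indicator (1 : E × E → ℝ≥0∞) p =
      A.indicator 1 p.1 ^ a * B.indicator 1 p.2 ^ b * S.indicator 1 (p.1 - p.2) ^ c := fun p => by
    by_cases h1 : p.1 ∈ A <;> by_cases h2 : p.2 ∈ B <;> by_cases h3 : p.1 - p.2 ∈ S <;>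
      simp [subTriple, h1, h2, h3, ha, hb, hc]
  simpa only [← hind, lintegral_indicator_one hA, lintegral_indicator_one hB,
    lintegral_indicator_one hS, lintegral_indicator_one (measurableSet_subTriple hA hB hS)] using
    hE (measurable_one.indicator hA) (measurable_one.indicator hB) (measurable_one.indicator hS)

end Tensor

theorem hasYoungBound_pi {C : ℝ≥0∞} (hC : C ≠ ∞) (h1 : HasYoungBound ℝ a b c C) (n : ℕ) :
    HasYoungBound (Fin n → ℝ) a b c (C ^ n) := by
  induction n with
  | zero =>
    intro f g h hf hg hh
    have hm : Measurable fun p : (Fin 0 → ℝ) × (Fin 0 → ℝ) =>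
        f p.1 ^ a * g p.2 ^ b * h (p.1 - p.2) ^ c := by fun_prop
    rw [lintegral_prod _ hm.aemeasurable]
    simp [Measure.volume_pi_eq_dirac (ι := Fin 0) 0]
  | succ n ih =>
    rw [pow_succ']
    refine (h1.prod ih (ENNReal.pow_ne_top hC)).of_measurePreserving
      (volume_preserving_piFinSuccAbove (fun _ : Fin (n + 1) => ℝ) 0).symm
      (MeasurableEquiv.measurableEmbedding _) fun x y => ?_
    ext i
    refine Fin.cases ?_ (fun j => ?_) i <;> simp [MeasurableEquiv.piFinSuccAbove_symm_apply]

theorem YoungExponents.hasYoungBound_euclideanSpace (he : YoungExponents a b c) (n : ℕ) :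
    HasYoungBound (EuclideanSpace ℝ (Fin n)) a b c
      (ENNReal.ofReal (youngFactor a * youngFactor b * youngFactor c) ^ n) :=
  (hasYoungBound_pi ENNReal.ofReal_ne_top he.hasYoungBound_real n).of_measurePreserving
    (PiLp.volume_preserving_toLp (Fin n))
    (MeasurableEquiv.toLp 2 (Fin n → ℝ)).measurableEmbedding fun _ _ => rfl

end YoungTensor

section PrekopaLeindler

open Filter
open scoped ENNReal

theorem volume_add_volume_le_of_isCompact {A B : Set ℝ} (hA : IsCompact A) (hB : IsCompact B)
    (hAn : A.Nonempty) (hBn : B.Nonempty) : volume A + volume B ≤ volume (A + B) := by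
  obtain ⟨a, ha, hamax⟩ := hA.exists_isGreatest hAn
  obtain ⟨b, hb, hbmin⟩ := hB.exists_isLeast hBn
  -- The translates `A + b` and `a + B` of `A` and `B` meet at most in `a + b`.
  have hd : AEDisjoint volume (A + {b}) ({a} + B) := by
    refine measure_mono_null ?_ (Real.volume_singleton (a := a + b))
    rintro _ ⟨⟨x, hx, _, rfl, rfl⟩, _, rfl, y, hy, hxy⟩
    replace hxy : _ + y = x + _ := hxy
    have hxa := hamax hx
    have hby := hbmin hy
    exact le_antisymm (by linarith) (by linarith)
  have hm : MeasurableSet ({a} + B) := (isCompact_singleton.add hB).measurableSet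
  calc volume A + volume B = volume (A + {b}) + volume ({a} + B) := by
        simp [measure_preimage_add_right]
    _ = volume (A + {b} ∪ ({a} + B)) := (measure_union₀ hm.nullMeasurableSet hd).symm
    _ ≤ volume (A + B) := measure_mono (union_subset
        (add_subset_add_left (singleton_subset_iff.2 hb))
        (add_subset_add_right (singleton_subset_iff.2 ha)))

theorem volume_add_volume_le_of_add_subset {A B C : Set ℝ} (hA : MeasurableSet A)
    (hB : MeasurableSet B) (hAn : A.Nonempty) (hBn : B.Nonempty) (hC : A + B ⊆ C) :
    volume A + volume B ≤ volume C := by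
  obtain ⟨a, ha⟩ := hAn
  obtain ⟨b, hb⟩ := hBn
  have hinner : ∀ {S : Set ℝ}, MeasurableSet S →
      volume S = ⨆ (K : Set ℝ) (_ : K ⊆ S ∧ IsCompact K), volume K := fun hS => by
    simp_rw [hS.measure_eq_iSup_isCompact, iSup_and]
  rw [hinner hA, hinner hB]
  refine ENNReal.biSup_add_biSup_le' ⟨∅, empty_subset _, isCompact_empty⟩
    ⟨∅, empty_subset _, isCompact_empty⟩ fun K ⟨hKA, hK⟩ L ⟨hLB, hL⟩ => ?_
  calc volume K + volume L ≤ volume (insert a K) + volume (insert b L) := by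
        gcongr <;> exact subset_insert _ _
    _ ≤ volume (insert a K + insert b L) := volume_add_volume_le_of_isCompact (hK.insert a)
        (hL.insert b) (insert_nonempty _ _) (insert_nonempty _ _)
    _ ≤ volume C := measure_mono ((add_subset_add (insert_subset ha hKA)
        (insert_subset hb hLB)).trans hC)

theorem lintegral_eq_lintegral_meas_ofReal_lt {α : Type*} [MeasurableSpace α] {μ : Measure α}
    {f : α → ℝ≥0∞} (hf : Measurable f) (hfin : ∀ x, f x ≠ ∞) :
    ∫⁻ x, f x ∂μ = ∫⁻ t in Ioi (0 : ℝ), μ {x | ENNReal.ofReal t < f x} := by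
  have h := lintegral_eq_lintegral_meas_lt μ (f := fun x => (f x).toReal)
    (.of_forall fun _ => ENNReal.toReal_nonneg) hf.ennreal_toReal.aemeasurable
  simp only [ENNReal.ofReal_toReal (hfin _)] at h
  rw [h]
  refine setLIntegral_congr_fun measurableSet_Ioi fun t ht => ?_
  simp only [ENNReal.ofReal_lt_iff_lt_toReal (le_of_lt ht) (hfin _)]

theorem tendsto_lintegral_min_natCast {α : Type*} [MeasurableSpace α] {μ : Measure α}
    {f : α → ℝ≥0∞} (hf : Measurable f) :
    Tendsto (fun k : ℕ => ∫⁻ x, min (f x) k ∂μ) atTop (𝓝 (∫⁻ x, f x ∂μ)) := by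
  refine lintegral_tendsto_of_tendsto_of_monotone
    (fun k => (hf.min measurable_const).aemeasurable)
    (.of_forall fun x i j hij => min_le_min_left _ (Nat.cast_le.2 hij)) (.of_forall fun x => ?_)
  simpa using (tendsto_const_nhds (x := f x)).min ENNReal.tendsto_nat_nhds_top

variable {a b : ℝ}

theorem rpow_mul_rpow_le_ofReal_mul_add (ha : 0 < a) (hb : 0 < b) (hab : a + b = 1)
    (x y : ℝ≥0∞) : x ^ a * y ^ b ≤ ENNReal.ofReal a * x + ENNReal.ofReal b * y := by
  have h := ENNReal.young_inequality (x ^ a) (y ^ b) (Real.HolderConjugate.inv_inv ha hb hab)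
  rwa [ENNReal.rpow_rpow_inv ha.ne', ENNReal.rpow_rpow_inv hb.ne', ENNReal.ofReal_inv_of_pos ha,
    ENNReal.ofReal_inv_of_pos hb, div_eq_mul_inv, div_eq_mul_inv, inv_inv, inv_inv, mul_comm x,
    mul_comm y] at h

/-- The Prékopa–Leindler inequality on `E` with weights `a` and `b`. -/
def HasPrekopaLeindler (E : Type*) [MeasureSpace E] [Add E] [SMul ℝ E] (a b : ℝ) : Prop :=
  ∀ ⦃f g h : E → ℝ≥0∞⦄, Measurable f → Measurable g → Measurable h →
    (∀ x y, f x ^ a * g y ^ b ≤ h (a • x + b • y)) →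
      (∫⁻ x, f x) ^ a * (∫⁻ x, g x) ^ b ≤ ∫⁻ x, h x

theorem volume_superlevel_add_le (ha : 0 < a) (hb : 0 < b) (hab : a + b = 1)
    {f g h : ℝ → ℝ≥0∞} (hf : Measurable f) (hg : Measurable g)
    (hfgh : ∀ x y, f x ^ a * g y ^ b ≤ h (a • x + b • y)) {s : ℝ≥0∞} (hs0 : s ≠ 0)
    (hst : s ≠ ∞) (hsf : s < ⨆ x, f x) (hsg : s < ⨆ x, g x) :
    ENNReal.ofReal a * volume {x | s < f x} + ENNReal.ofReal b * volume {x | s < g x} ≤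
      volume {x | s < h x} := by
  have hscale : ∀ {c : ℝ}, 0 < c → ∀ S : Set ℝ, ENNReal.ofReal c * volume S = volume (c • S) :=
    fun hc S => by simp [Measure.addHaar_smul_of_nonneg _ hc.le]
  rw [hscale ha, hscale hb]
  refine volume_add_volume_le_of_add_subset
    ((measurableSet_lt measurable_const hf).const_smul₀ _)
    ((measurableSet_lt measurable_const hg).const_smul₀ _) (Nonempty.smul_set (lt_iSup_iff.1 hsf))
    (Nonempty.smul_set (lt_iSup_iff.1 hsg)) ?_
  rintro _ ⟨_, ⟨x, hx, rfl⟩, _, ⟨y, hy, rfl⟩, rfl⟩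
  calc s = s ^ a * s ^ b := by rw [← ENNReal.rpow_add _ _ hs0 hst, hab, ENNReal.rpow_one]
    _ < f x ^ a * g y ^ b :=
        ENNReal.mul_lt_mul (ENNReal.rpow_lt_rpow hx ha) (ENNReal.rpow_lt_rpow hy hb)
    _ ≤ h (a • x + b • y) := hfgh x y

theorem lintegral_add_le_of_iSup_eq_one (ha : 0 < a) (hb : 0 < b) (hab : a + b = 1)
    {f g h : ℝ → ℝ≥0∞} (hf : Measurable f) (hg : Measurable g) (hh : Measurable h)
    (hf1 : ⨆ x, f x = 1) (hg1 : ⨆ x, g x = 1)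
    (hfgh : ∀ x y, f x ^ a * g y ^ b ≤ h (a • x + b • y)) :
    ENNReal.ofReal a * (∫⁻ x, f x) + ENNReal.ofReal b * (∫⁻ x, g x) ≤ ∫⁻ x, h x := by
  have hle : ∀ {φ : ℝ → ℝ≥0∞}, ⨆ x, φ x = 1 → ∀ x, φ x ≤ 1 := fun hφ x => hφ ▸ le_iSup _ x
  have hfin : ∀ {φ : ℝ → ℝ≥0∞}, (∀ x, φ x ≤ 1) → ∀ x, φ x ≠ ∞ := fun hφ x =>
    ((hφ x).trans_lt ENNReal.one_lt_top).ne
  have hf_meas : Measurable fun t => volume {x | ENNReal.ofReal t < f x} :=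
    Antitone.measurable fun s t hst => measure_mono fun x hx =>
      (ENNReal.ofReal_le_ofReal hst).trans_lt hx
  refine le_trans ?_ (lintegral_mono fun x => min_le_left (h x) 1)
  rw [lintegral_eq_lintegral_meas_ofReal_lt hf (hfin (hle hf1)),
    lintegral_eq_lintegral_meas_ofReal_lt hg (hfin (hle hg1)),
    lintegral_eq_lintegral_meas_ofReal_lt (hh.min measurable_const)
      (hfin fun x => min_le_right _ _),
    ← lintegral_const_mul' _ _ ENNReal.ofReal_ne_top,
    ← lintegral_const_mul' _ _ ENNReal.ofReal_ne_top, ← lintegral_add_left (hf_meas.const_mul _)]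
  refine setLIntegral_mono' measurableSet_Ioi fun t ht => ?_
  by_cases ht1 : 1 ≤ ENNReal.ofReal t
  · have hempty : ∀ {φ : ℝ → ℝ≥0∞}, ⨆ x, φ x = 1 → {x | ENNReal.ofReal t < φ x} = ∅ := fun hφ =>
      eq_empty_of_forall_notMem fun x hx => not_lt.2 ((hle hφ x).trans ht1) hx
    simp [hempty hf1, hempty hg1]
  · push Not at ht1
    simpa only [lt_min_iff, ht1, and_true] using
      volume_superlevel_add_le ha hb hab hf hg hfgh (ENNReal.ofReal_pos.2 ht).ne'
      ENNReal.ofReal_ne_top (hf1 ▸ ht1) (hg1 ▸ ht1)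

theorem rpow_lintegral_mul_le_of_iSup_ne_top (ha : 0 < a) (hb : 0 < b) (hab : a + b = 1)
    {f g h : ℝ → ℝ≥0∞} (hf : Measurable f) (hg : Measurable g) (hh : Measurable h)
    (hft : ⨆ x, f x ≠ ∞) (hgt : ⨆ x, g x ≠ ∞)
    (hfgh : ∀ x y, f x ^ a * g y ^ b ≤ h (a • x + b • y)) :
    (∫⁻ x, f x) ^ a * (∫⁻ x, g x) ^ b ≤ ∫⁻ x, h x := by
  rcases eq_or_ne (⨆ x, f x) 0 with hf0 | hf0
  · simp [(by simpa using hf0 : ∀ x, f x = 0), ha]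
  rcases eq_or_ne (⨆ x, g x) 0 with hg0 | hg0
  · simp [(by simpa using hg0 : ∀ x, g x = 0), hb]
  set A := ⨆ x, f x
  set B := ⨆ x, g x
  set k := (A ^ a)⁻¹ * (B ^ b)⁻¹
  have hsplit : ∀ x y, (A⁻¹ * x) ^ a * (B⁻¹ * y) ^ b = k * (x ^ a * y ^ b) := fun x y => by
    rw [ENNReal.mul_rpow_of_nonneg _ _ ha.le, ENNReal.mul_rpow_of_nonneg _ _ hb.le,
      ENNReal.inv_rpow, ENNReal.inv_rpow, mul_mul_mul_comm]
  have hk0 : k ≠ 0 := mul_ne_zero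
    (ENNReal.inv_ne_zero.2 (ENNReal.rpow_ne_top_of_nonneg ha.le hft))
    (ENNReal.inv_ne_zero.2 (ENNReal.rpow_ne_top_of_nonneg hb.le hgt))
  have hkt : k ≠ ∞ := ENNReal.mul_ne_top (by simp [hf0, ha.le]) (by simp [hg0, hb.le])
  have hnormalised := lintegral_add_le_of_iSup_eq_one ha hb hab (hf.const_mul A⁻¹)
    (hg.const_mul B⁻¹) (hh.const_mul k)
    (by rw [← ENNReal.mul_iSup, ENNReal.inv_mul_cancel hf0 hft])
    (by rw [← ENNReal.mul_iSup, ENNReal.inv_mul_cancel hg0 hgt])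
    (fun x y => (hsplit _ _).trans_le (mul_le_mul' le_rfl (hfgh x y)))
  have hscaled := (rpow_mul_rpow_le_ofReal_mul_add ha hb hab _ _).trans hnormalised
  rw [lintegral_const_mul _ hf, lintegral_const_mul _ hg, lintegral_const_mul _ hh,
    hsplit] at hscaled
  exact (ENNReal.mul_le_mul_iff_right hk0 hkt).1 hscaled

theorem hasPrekopaLeindler_real (ha : 0 < a) (hb : 0 < b) (hab : a + b = 1) :
    HasPrekopaLeindler ℝ a b := by
  intro f g h hf hg hh hfgh
  rcases eq_or_ne (∫⁻ x, f x) 0 with hf0 | hf0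
  · simp [hf0, ha]
  rcases eq_or_ne (∫⁻ x, g x) 0 with hg0 | hg0
  · simp [hg0, hb]
  have hlim := ENNReal.Tendsto.mul
    ((tendsto_lintegral_min_natCast (μ := volume) hf).ennrpow_const a)
    (.inl (by simp [hf0, ha.le]))
    ((tendsto_lintegral_min_natCast (μ := volume) hg).ennrpow_const b) (.inl (by simp [hg0, hb.le]))
  refine le_of_tendsto hlim (.of_forall fun k => ?_)
  have hbdd : ∀ φ : ℝ → ℝ≥0∞, ⨆ x, min (φ x) (k : ℝ≥0∞) ≠ ∞ := fun φ =>
    ((iSup_le fun x => min_le_right _ _).trans_lt (ENNReal.natCast_lt_top k)).ne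
  refine rpow_lintegral_mul_le_of_iSup_ne_top ha hb hab (hf.min measurable_const)
    (hg.min measurable_const) hh (hbdd f) (hbdd g) fun x y => le_trans ?_ (hfgh x y)
  gcongr <;> exact min_le_left _ _

section Tensor

variable {E F : Type*} [MeasureSpace E] [MeasureSpace F] [Add E] [Add F] [SMul ℝ E] [SMul ℝ F]

theorem HasPrekopaLeindler.of_measurePreserving (hE : HasPrekopaLeindler E a b) {e : E → F}
    (he : MeasurePreserving e) (hadd : ∀ x y, e (x + y) = e x + e y)
    (hsmul : ∀ (c : ℝ) x, e (c • x) = c • e x) : HasPrekopaLeindler F a b := by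
  intro f g h hf hg hh hfgh
  rw [← he.lintegral_comp hf, ← he.lintegral_comp hg, ← he.lintegral_comp hh]
  refine hE (hf.comp he.measurable) (hg.comp he.measurable) (hh.comp he.measurable) fun x y => ?_
  simpa only [Function.comp_apply, hadd, hsmul] using hfgh (e x) (e y)

theorem HasPrekopaLeindler.prod [SFinite (volume : Measure F)]
    (hE : HasPrekopaLeindler E a b) (hF : HasPrekopaLeindler F a b) :
    HasPrekopaLeindler (E × F) a b := by
  intro f g h hf hg hh hfgh
  simp only [Measure.volume_eq_prod, lintegral_prod _ hf.aemeasurable,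
    lintegral_prod _ hg.aemeasurable, lintegral_prod _ hh.aemeasurable]
  exact hE hf.lintegral_prod_right' hg.lintegral_prod_right' hh.lintegral_prod_right' fun s t =>
    hF (hf.comp measurable_prodMk_left) (hg.comp measurable_prodMk_left)
      (hh.comp measurable_prodMk_left) fun x y => hfgh (s, x) (t, y)

end Tensor

theorem hasPrekopaLeindler_pi (ha : 0 < a) (hb : 0 < b) (hab : a + b = 1) (n : ℕ) :
    HasPrekopaLeindler (Fin n → ℝ) a b := by
  induction n with
  | zero =>
    intro f g h _ _ _ hfgh
    simpa only [Measure.volume_pi_eq_dirac (ι := Fin 0) 0, lintegral_dirac,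
      Subsingleton.elim (a • (0 : Fin 0 → ℝ) + b • 0) 0] using hfgh 0 0
  | succ n ih =>
    refine ((hasPrekopaLeindler_real ha hb hab).prod ih).of_measurePreserving
      (volume_preserving_piFinSuccAbove (fun _ : Fin (n + 1) => ℝ) 0).symm (fun x y => ?_)
      fun c x => ?_ <;>
    · ext i
      refine Fin.cases ?_ (fun j => ?_) i <;> simp [MeasurableEquiv.piFinSuccAbove_symm_apply]

theorem hasPrekopaLeindler_euclideanSpace (ha : 0 < a) (hb : 0 < b) (hab : a + b = 1) (n : ℕ) :
    HasPrekopaLeindler (EuclideanSpace ℝ (Fin n)) a b :=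
  (hasPrekopaLeindler_pi ha hb hab n).of_measurePreserving (PiLp.volume_preserving_toLp (Fin n))
    (fun _ _ => rfl) fun _ _ => rfl

theorem HasPrekopaLeindler.volume_rpow_mul_rpow_le {E : Type*} [MeasureSpace E] [Add E]
    [SMul ℝ E] (hE : HasPrekopaLeindler E a b) (ha : 0 < a) (hb : 0 < b) {A B C : Set E}
    (hA : MeasurableSet A) (hB : MeasurableSet B) (hC : MeasurableSet C)
    (hABC : ∀ x ∈ A, ∀ y ∈ B, a • x + b • y ∈ C) :
    volume A ^ a * volume B ^ b ≤ volume C := by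
  rw [← lintegral_indicator_one hA, ← lintegral_indicator_one hB, ← lintegral_indicator_one hC]
  refine hE (measurable_one.indicator hA) (measurable_one.indicator hB)
    (measurable_one.indicator hC) fun x y => ?_
  by_cases hx : x ∈ A
  · by_cases hy : y ∈ B
    · simp [hx, hy, hABC x hx y hy]
    · simp [hy, hb]
  · simp [hx, ha]

end PrekopaLeindler

section DifferenceConcentration

open scoped ENNReal

theorem youngFactor_eq_exp {t : ℝ} (h0 : 0 < t) (h1 : t < 1) :
    youngFactor t = Real.exp (((1 - t) * Real.log (1 - t) - t * Real.log t) / 2) := by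
  have h1t : 0 < 1 - t := sub_pos.2 h1
  rw [youngFactor, Real.rpow_def_of_pos (Real.sqrt_pos.2 h1t),
    Real.rpow_def_of_pos (Real.sqrt_pos.2 h0), ← Real.exp_sub, Real.log_sqrt h1t.le,
    Real.log_sqrt h0.le]
  ring_nf

theorem youngFactor_mul_youngFactor_mul_youngFactor {a c ε : ℝ} (he : YoungExponents a a c)
    (hε : 0 < ε) (hc : 1 - c = a * ε ^ 2 / 2) :
    youngFactor a * youngFactor a * youngFactor c = ε / √(2 * a) / ε ^ c := by
  have ha := he.pos_left
  have hsum := he.add_eq_two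
  have hlog_c : Real.log (1 - c) = Real.log a + 2 * Real.log ε - Real.log 2 := by
    rw [hc, Real.log_div (by positivity) two_ne_zero, Real.log_mul ha.ne' (by positivity),
      Real.log_pow, Nat.cast_two]
  have hlog_a : Real.log (1 - a) = Real.log c - Real.log 2 := by
    rw [← Real.log_div he.pos_right.ne' two_ne_zero]
    congr 1
    linarith
  have hc_eq : c = 2 - 2 * a := by linarith
  have hrhs : ε / √(2 * a) / ε ^ c =
      Real.exp (Real.log ε - (Real.log 2 + Real.log a) / 2 - Real.log ε * c) := by
    rw [Real.exp_sub, Real.exp_sub, Real.exp_log hε, Real.rpow_def_of_pos hε,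
      ← Real.log_mul two_ne_zero ha.ne', ← Real.log_sqrt (by positivity),
      Real.exp_log (by positivity)]
  rw [hrhs, youngFactor_eq_exp ha he.lt_one_left, youngFactor_eq_exp he.pos_right he.lt_one_right,
    ← Real.exp_add, ← Real.exp_add, hlog_c, hlog_a, hc_eq]
  ring_nf

/-- The exponents solve `1 - c = a * ε ^ 2 / 2`, the relation under which the sharp constant
collapses to the closed form of `youngFactor_mul_youngFactor_mul_youngFactor`. -/
theorem youngExponents_of_lt_sqrt_two {ε : ℝ} (hε₀ : 0 < ε) (hε₁ : ε < √2) :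
    YoungExponents (2 / (4 - ε ^ 2)) (2 / (4 - ε ^ 2)) (2 * (2 - ε ^ 2) / (4 - ε ^ 2)) := by
  have h2 := (Real.lt_sqrt hε₀.le).1 hε₁
  have hsq : 0 < ε ^ 2 := by positivity
  have h4 : 0 < 4 - ε ^ 2 := by linarith
  have ha0 : 0 < 2 / (4 - ε ^ 2) := by positivity
  have ha1 : 2 / (4 - ε ^ 2) < 1 := (div_lt_one h4).2 (by linarith)
  exact ⟨ha0, ha0, div_pos (by linarith) h4, ha1, ha1, (div_lt_one h4).2 (by linarith),
    by field_simp; ring⟩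

theorem volume_subTriple_smul_le {n : ℕ} {K : Set (EuclideanSpace ℝ (Fin n))}
    (hK : MeasurableSet K) {ε : ℝ} (hε₀ : 0 < ε) (hε₁ : ε < √2) :
    (volume.prod volume) (subTriple K K (ε • K)) ≤
      ENNReal.ofReal (ε * √(1 - ε ^ 2 / 4)) ^ n * volume K ^ 2 := by
  have he := youngExponents_of_lt_sqrt_two hε₀ hε₁
  have h2 := (Real.lt_sqrt hε₀.le).1 hε₁
  have h4 : 4 - ε ^ 2 ≠ 0 := by linarith
  have hfactor := youngFactor_mul_youngFactor_mul_youngFactor he hε₀ (by field_simp; ring)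
  have hroot : ε / √(2 * (2 / (4 - ε ^ 2))) = ε * √(1 - ε ^ 2 / 4) := by
    rw [div_eq_mul_inv, ← Real.sqrt_inv]
    congr 2
    field_simp
    ring
  have hbound := (he.hasYoungBound_euclideanSpace n).volume_subTriple_le he.pos_left he.pos_mid
    he.pos_right hK hK (hK.const_smul₀ ε)
  rw [hfactor, hroot] at hbound
  generalize 2 / (4 - ε ^ 2) = a at *
  generalize 2 * (2 - ε ^ 2) / (4 - ε ^ 2) = c at *
  have hεc : 0 < ε ^ c := Real.rpow_pos_of_pos hε₀ c
  have hvol : volume (ε • K) ^ c = ENNReal.ofReal (ε ^ c) ^ n * volume K ^ c := by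
    rw [Measure.addHaar_smul_of_nonneg _ hε₀.le, ENNReal.mul_rpow_of_nonneg _ _ he.pos_right.le,
      finrank_euclideanSpace_fin, ENNReal.ofReal_pow hε₀.le, ← ENNReal.ofReal_rpow_of_pos hε₀,
      ← ENNReal.rpow_natCast, ← ENNReal.rpow_natCast, ← ENNReal.rpow_mul, ← ENNReal.rpow_mul,
      mul_comm c]
  have hK2 : volume K ^ a * volume K ^ a * volume K ^ c = volume K ^ 2 := by
    rw [← ENNReal.rpow_add_of_nonneg _ _ he.pos_left.le he.pos_left.le,
      ← ENNReal.rpow_add_of_nonneg _ _ (by linarith [he.pos_left]) he.pos_right.le, he.add_eq_two,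
      ENNReal.rpow_two]
  calc (volume.prod volume) (subTriple K K (ε • K))
      ≤ _ := hbound
    _ = (ENNReal.ofReal (ε * √(1 - ε ^ 2 / 4) / ε ^ c) * ENNReal.ofReal (ε ^ c)) ^ n *
          (volume K ^ a * volume K ^ a * volume K ^ c) := by rw [hvol, mul_pow]; ring
    _ = _ := by rw [hK2, ← ENNReal.ofReal_mul (by positivity), div_mul_cancel₀ _ hεc.ne']

theorem mul_sqrt_le_exp {ε : ℝ} (hε₀ : 0 < ε) :
    ε * √(1 - ε ^ 2 / 4) ≤ Real.exp (-((√2 - ε) ^ 2 / 4)) := by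
  have h2 : √2 ^ 2 = 2 := Real.sq_sqrt (by norm_num)
  -- With `s = ε ^ 2 / 2`, the square of the left side is `s * (2 - s) = 1 - (1 - s) ^ 2`.
  have hs : (√2 - ε) ^ 2 / 2 ≤ (1 - ε ^ 2 / 2) ^ 2 := by
    have hfac : 1 - ε ^ 2 / 2 = (√2 - ε) * (√2 + ε) / 2 := by linear_combination (-1 / 2) * h2
    have hsum : 2 ≤ (√2 + ε) ^ 2 := by nlinarith [Real.sqrt_nonneg 2]
    rw [hfac]
    nlinarith [mul_le_mul_of_nonneg_left hsum (sq_nonneg (√2 - ε))]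
  rw [← Real.sqrt_sq hε₀.le, ← Real.sqrt_mul (sq_nonneg ε), Real.sqrt_sq hε₀.le]
  refine Real.sqrt_le_iff.2 ⟨(Real.exp_pos _).le, ?_⟩
  calc ε ^ 2 * (1 - ε ^ 2 / 4) ≤ -((√2 - ε) ^ 2 / 2) + 1 := by linarith
    _ ≤ Real.exp (-((√2 - ε) ^ 2 / 2)) := Real.add_one_le_exp _
    _ = Real.exp (-((√2 - ε) ^ 2 / 4)) ^ 2 := by rw [← Real.exp_nat_mul]; ring_nf

theorem volume_subTriple_smul_le_exp {n : ℕ} {K : Set (EuclideanSpace ℝ (Fin n))}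
    (hK : MeasurableSet K) {ε : ℝ} (hε₀ : 0 < ε) (hε₁ : ε < √2) :
    (volume.prod volume) (subTriple K K (ε • K)) ≤
      ENNReal.ofReal (Real.exp (-((√2 - ε) ^ 2 / 4 * n))) * volume K ^ 2 := by
  refine (volume_subTriple_smul_le hK hε₀ hε₁).trans ?_
  rw [← neg_mul, mul_comm _ (n : ℝ), Real.exp_nat_mul, ENNReal.ofReal_pow (Real.exp_pos _).le]
  gcongr
  exact mul_sqrt_le_exp hε₀

end DifferenceConcentration

section LogConcave

variable {E : Type*} [NormedAddCommGroup E] [NormedSpace ℝ E]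

theorem isOpen_strict_hypograph_of_concaveOn [FiniteDimensional ℝ E] {U : Set E} {ψ : E → ℝ}
    (hU : IsOpen U) (hψ : ConcaveOn ℝ U ψ) : IsOpen {p : E × ℝ | p.1 ∈ U ∧ p.2 < ψ p.1} := by
  have hcont : ContinuousOn ψ U := by simpa only [hU.interior_eq] using hψ.continuousOn_interior
  have hgap : ContinuousOn (fun p : E × ℝ => ψ p.1 - p.2) (U ×ˢ univ) :=
    (hcont.comp continuousOn_fst fun p hp => hp.1).sub continuousOn_snd
  convert hgap.isOpen_inter_preimage (hU.prod isOpen_univ) (isOpen_Ioi (a := (0 : ℝ)))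
    using 1
  ext p
  simp

theorem exists_le_add_of_concaveOn [FiniteDimensional ℝ E] {U : Set E} {ψ : E → ℝ} (hU : IsOpen U)
    (hψ : ConcaveOn ℝ U ψ) {x₀ : E} (hx₀ : x₀ ∈ U) :
    ∃ ℓ : E →L[ℝ] ℝ, ∀ z ∈ U, ψ z ≤ ψ x₀ + ℓ (z - x₀) := by
  obtain ⟨F, hF⟩ := geometric_hahn_banach_open_point hψ.convex_strict_hypograph
    (isOpen_strict_hypograph_of_concaveOn hU hψ) (x := (x₀, ψ x₀)) (by simp)
  have hsplit (z : E) (s : ℝ) : F (z, s) = F (z, 0) + s * F (0, 1) := by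
    rw [← smul_eq_mul, ← map_smul, ← map_add]
    simp
  set κ := F (0, 1)
  have hκ : 0 < κ := by
    have := hF (x₀, ψ x₀ - 1) ⟨hx₀, by simp⟩
    rw [hsplit _ (ψ x₀ - 1), hsplit _ (ψ x₀)] at this
    linarith
  refine ⟨-(κ⁻¹ • F.comp (ContinuousLinearMap.inl ℝ E ℝ)), fun z hz => ?_⟩
  have hle : F (z, 0) + ψ z * κ ≤ F (x₀, 0) + ψ x₀ * κ := by
    refine le_of_forall_pos_lt_add fun η hη => ?_
    have := hF (z, ψ z - η / κ) ⟨hz, sub_lt_self _ (by positivity)⟩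
    rw [hsplit z (ψ z - η / κ), hsplit x₀ (ψ x₀), sub_mul, div_mul_cancel₀ _ hκ.ne'] at this
    linarith
  have hFsub : F (z - x₀, 0) = F (z, 0) - F (x₀, 0) := by rw [← map_sub]; simp
  have hval : (-(κ⁻¹ • F.comp (ContinuousLinearMap.inl ℝ E ℝ))) (z - x₀) =
      (F (x₀, 0) - F (z, 0)) / κ := by
    simp only [neg_apply, smul_apply, ContinuousLinearMap.comp_apply,
      ContinuousLinearMap.inl_apply, hFsub, smul_eq_mul]
    ring
  rw [hval, ← sub_le_iff_le_add', le_div_iff₀ hκ]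
  linarith

/-- Log-concavity of a nonnegative function on a real vector space, in multiplicative form so that
zero values are allowed. -/
structure IsLogConcave {E : Type*} [AddCommGroup E] [Module ℝ E] (f : E → ℝ) : Prop where
  nonneg : ∀ x, 0 ≤ f x
  rpow_mul_rpow_le : ∀ x y {a b : ℝ}, 0 < a → 0 < b → a + b = 1 →
    f x ^ a * f y ^ b ≤ f (a • x + b • y)

theorem IsLogConcave.concaveOn_log {f : E → ℝ} (hf : IsLogConcave f) {U : Set E}
    (hU : Convex ℝ U) (hpos : ∀ x ∈ U, 0 < f x) : ConcaveOn ℝ U fun x => Real.log (f x) := by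
  refine concaveOn_iff_forall_pos.2 ⟨hU, fun x hx y hy a b ha hb hab => ?_⟩
  have hxa := Real.rpow_pos_of_pos (hpos x hx) a
  have hyb := Real.rpow_pos_of_pos (hpos y hy) b
  rw [smul_eq_mul, smul_eq_mul, ← Real.log_rpow (hpos x hx), ← Real.log_rpow (hpos y hy),
    ← Real.log_mul hxa.ne' hyb.ne']
  exact Real.log_le_log (mul_pos hxa hyb) (hf.rpow_mul_rpow_le x y ha hb hab)

theorem IsLogConcave.exists_le_mul_exp [FiniteDimensional ℝ E] {f : E → ℝ}
    (hf : IsLogConcave f) {x₀ : E} (hpos : ∀ᶠ x in 𝓝 x₀, 0 < f x) :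
    ∃ ℓ : E →L[ℝ] ℝ, ∀ z, f z ≤ f x₀ * Real.exp (ℓ (z - x₀)) := by
  obtain ⟨δ, hδ, hball⟩ := Metric.eventually_nhds_iff_ball.1 hpos
  obtain ⟨ℓ, hℓ⟩ := exists_le_add_of_concaveOn Metric.isOpen_ball
    (hf.concaveOn_log (convex_ball x₀ δ) hball) (Metric.mem_ball_self hδ)
  have h₀ : 0 < f x₀ := hpos.self_of_nhds
  refine ⟨ℓ, fun z => ?_⟩
  -- Log-concavity on the segment from `x₀` to `z` propagates the bound from the ball to `z`.
  have hnear : ∀ᶠ t : ℝ in 𝓝[>] 0, t • z + (1 - t) • x₀ ∈ Metric.ball x₀ δ := by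
    have hc : Continuous fun t : ℝ => t • z + (1 - t) • x₀ := by fun_prop
    exact (hc.tendsto' 0 x₀ (by simp)).mono_left nhdsWithin_le_nhds
      (Metric.ball_mem_nhds x₀ hδ)
  obtain ⟨t, ⟨ht, ht₀, ht₁⟩⟩ := (hnear.and (Ioo_mem_nhdsGT one_pos)).exists
  have hseg : f (t • z + (1 - t) • x₀) ≤ f x₀ * Real.exp (t * ℓ (z - x₀)) := by
    have := hℓ _ ht
    rw [show t • z + (1 - t) • x₀ - x₀ = t • (z - x₀) by module, map_smul, smul_eq_mul] at this
    rwa [← Real.exp_log h₀, ← Real.exp_add, ← Real.log_le_iff_le_exp (hball _ ht)]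
  have hroot : f z ^ t ≤ (f x₀ * Real.exp (ℓ (z - x₀))) ^ t := by
    rw [Real.mul_rpow h₀.le (Real.exp_pos _).le, ← Real.exp_mul,
      mul_comm (ℓ _)]
    refine le_of_mul_le_mul_right ?_ (Real.rpow_pos_of_pos h₀ (1 - t))
    calc f z ^ t * f x₀ ^ (1 - t) ≤ f (t • z + (1 - t) • x₀) :=
          hf.rpow_mul_rpow_le z x₀ ht₀ (sub_pos.2 ht₁) (add_sub_cancel _ _)
      _ ≤ f x₀ * Real.exp (t * ℓ (z - x₀)) := hseg
      _ = f x₀ ^ (t + (1 - t)) * Real.exp (t * ℓ (z - x₀)) := by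
          rw [add_sub_cancel, Real.rpow_one]
      _ = _ := by rw [Real.rpow_add h₀]; ring
  exact (Real.rpow_le_rpow_iff (hf.nonneg z) (by positivity) ht₀).1 hroot

end LogConcave

section ExponentialIntegrals

open scoped ENNReal

theorem ofReal_exp_integral_le_lintegral {Ω : Type*} [MeasurableSpace Ω] {P : Measure Ω}
    [IsProbabilityMeasure P] {u : Ω → ℝ} (hu : Integrable u P) :
    ENNReal.ofReal (Real.exp (∫ x, u x ∂P)) ≤ ∫⁻ x, ENNReal.ofReal (Real.exp (u x)) ∂P := by
  have hnn : 0 ≤ᵐ[P] fun x => Real.exp (u x) := .of_forall fun x => (Real.exp_pos _).le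
  by_cases hexp : Integrable (fun x => Real.exp (u x)) P
  · rw [← ofReal_integral_eq_lintegral_ofReal hexp hnn]
    exact ENNReal.ofReal_le_ofReal (convexOn_exp.map_integral_le Real.continuous_exp.continuousOn
      isClosed_univ (.of_forall fun _ => mem_univ _) hu hexp)
  · have htop : ∫⁻ x, ENNReal.ofReal (Real.exp (u x)) ∂P = ∞ := by
      by_contra h
      exact hexp ⟨Real.continuous_exp.comp_aestronglyMeasurable hu.1,
        (hasFiniteIntegral_iff_ofReal hnn).2 (lt_top_iff_ne_top.2 h)⟩
    simp only [htop, le_top]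

/-- Gibbs' inequality when the density is dominated by an exponential tilt of mean zero. -/
theorem ofReal_exp_neg_integral_le {Ω : Type*} [MeasurableSpace Ω] {ν : Measure Ω}
    {ρ : Ω → ℝ≥0∞} [IsProbabilityMeasure (ν.withDensity ρ)] (hρ : Measurable ρ) {D : ℝ≥0∞}
    {ℓ φ : Ω → ℝ} (hℓm : Measurable ℓ) (hφm : Measurable φ)
    (hℓ : Integrable ℓ (ν.withDensity ρ)) (hφ : Integrable φ (ν.withDensity ρ))
    (hρℓ : ∀ z, ρ z ≤ D * ENNReal.ofReal (Real.exp (ℓ z)))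
    (hmean : ∫ z, ℓ z ∂(ν.withDensity ρ) = 0) :
    ENNReal.ofReal (Real.exp (-∫ z, φ z ∂(ν.withDensity ρ))) ≤
      D * ∫⁻ z, ENNReal.ofReal (Real.exp (-φ z)) ∂ν := by
  have hinteg : ∫ z, (-φ z - ℓ z) ∂(ν.withDensity ρ) = -∫ z, φ z ∂(ν.withDensity ρ) := by
    rw [integral_sub (f := fun z => -φ z) hφ.neg hℓ, hmean, sub_zero, integral_neg]
  calc ENNReal.ofReal (Real.exp (-∫ z, φ z ∂(ν.withDensity ρ)))
      ≤ ∫⁻ z, ENNReal.ofReal (Real.exp (-φ z - ℓ z)) ∂(ν.withDensity ρ) := by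
        rw [← hinteg]
        exact ofReal_exp_integral_le_lintegral (hφ.neg.sub hℓ)
    _ = ∫⁻ z, ρ z * ENNReal.ofReal (Real.exp (-φ z - ℓ z)) ∂ν :=
        lintegral_withDensity_eq_lintegral_mul _ hρ (by fun_prop)
    _ ≤ ∫⁻ z, D * ENNReal.ofReal (Real.exp (-φ z)) ∂ν := by
        refine lintegral_mono fun z => (mul_le_mul_left (hρℓ z) _).trans_eq ?_
        rw [mul_assoc, ← ENNReal.ofReal_mul (Real.exp_pos _).le, ← Real.exp_add,
          add_sub_cancel]
    _ = _ := lintegral_const_mul _ (by fun_prop)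

theorem ofReal_exp_neg_eq_setLIntegral_Ioi {c : ℝ} (hc : 0 < c) (s : ℝ) :
    ENNReal.ofReal (Real.exp (-(c * s))) =
      ∫⁻ t in Ioi s, ENNReal.ofReal (c * Real.exp (-c * t)) := by
  rw [← ofReal_integral_eq_lintegral_ofReal
    ((integrableOn_exp_mul_Ioi (neg_lt_zero.2 hc) s).const_mul c)
    (.of_forall fun t => by positivity), integral_const_mul,
    integral_exp_mul_Ioi (neg_lt_zero.2 hc)]
  congr 1
  field_simp

theorem lintegral_ofReal_exp_neg_eq {Ω : Type*} [MeasurableSpace Ω] {ν : Measure Ω} [SFinite ν]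
    {g : Ω → ℝ} (hg : Measurable g) (hg0 : ∀ z, 0 ≤ g z) {c : ℝ} (hc : 0 < c) :
    ∫⁻ z, ENNReal.ofReal (Real.exp (-(c * g z))) ∂ν =
      ∫⁻ t in Ioi 0, ENNReal.ofReal (c * Real.exp (-c * t)) * ν {z | g z < t} := by
  have hinner (z : Ω) : ENNReal.ofReal (Real.exp (-(c * g z))) =
      ∫⁻ t in Ioi 0,
        {t | g z < t}.indicator (fun t => ENNReal.ofReal (c * Real.exp (-c * t))) t := by
    rw [show {t | g z < t} = Ioi (g z) from rfl, lintegral_indicator measurableSet_Ioi,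
      Measure.restrict_restrict measurableSet_Ioi, ofReal_exp_neg_eq_setLIntegral_Ioi hc,
      inter_eq_left.2]
    exact Ioi_subset_Ioi (hg0 z)
  simp only [hinner]
  rw [lintegral_lintegral_swap]
  · refine lintegral_congr fun t => ?_
    exact lintegral_indicator_const (measurableSet_lt hg measurable_const) _
  · exact (Measurable.indicator (by fun_prop : Measurable fun p : Ω × ℝ =>
      ENNReal.ofReal (c * Real.exp (-c * p.2)))
      (measurableSet_lt (hg.comp measurable_fst) measurable_snd)).aemeasurable

theorem setLIntegral_Ioi_ofReal_mul_exp_neg_mul_pow {c : ℝ} (hc : 0 < c) (n : ℕ) :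
    ∫⁻ t in Ioi (0 : ℝ), ENNReal.ofReal (c * Real.exp (-c * t) * t ^ n) =
      ENNReal.ofReal (n.factorial / c ^ n) := by
  have hinteg : ∫ t in Ioi (0 : ℝ), c * Real.exp (-c * t) * t ^ n = n.factorial / c ^ n := by
    have hΓ := Real.integral_rpow_mul_exp_neg_mul_Ioi (a := n + 1) (by positivity) hc
    rw [Real.Gamma_nat_eq_factorial, add_sub_cancel_right, Real.rpow_add_one (by positivity),
      Real.rpow_natCast] at hΓ
    calc ∫ t in Ioi (0 : ℝ), c * Real.exp (-c * t) * t ^ n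
        = c * ∫ t in Ioi (0 : ℝ), t ^ (n : ℝ) * Real.exp (-(c * t)) := by
          rw [← integral_const_mul]
          congr with t
          rw [Real.rpow_natCast, neg_mul]
          ring
      _ = n.factorial / c ^ n := by rw [hΓ, one_div_pow]; field_simp
  rw [← hinteg, ofReal_integral_eq_lintegral_ofReal]
  · exact .of_integral_ne_zero (by rw [hinteg]; positivity)
  · filter_upwards [ae_restrict_mem measurableSet_Ioi] with t (ht : 0 < t)
    positivity

variable {E : Type*} [NormedAddCommGroup E] [NormedSpace ℝ E] {K : Set E}

theorem mem_smul_of_gauge_le (hK : Convex ℝ K) (hKc : IsClosed K) (h0 : K ∈ 𝓝 0) {t : ℝ}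
    (ht : 0 < t) {x : E} (hx : gauge K x ≤ t) : x ∈ t • K := by
  rwa [mem_smul_set_iff_inv_smul_mem₀ ht.ne', ← hKc.closure_eq,
    ← gauge_le_one_iff_mem_closure hK h0, gauge_smul_of_nonneg (inv_nonneg.2 ht.le), smul_eq_mul,
    inv_mul_le_one₀ ht]

theorem lintegral_exp_neg_gauge_le [FiniteDimensional ℝ E] [MeasurableSpace E] [BorelSpace E]
    {μ : Measure E} [μ.IsAddHaarMeasure] (hK : Convex ℝ K) (hKc : IsClosed K) (h0 : K ∈ 𝓝 0)
    {c : ℝ} (hc : 0 < c) :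
    ∫⁻ z, ENNReal.ofReal (Real.exp (-(c * gauge K z))) ∂μ ≤
      ENNReal.ofReal ((Module.finrank ℝ E).factorial / c ^ Module.finrank ℝ E) * μ K := by
  rw [lintegral_ofReal_exp_neg_eq (continuous_gauge hK h0).measurable gauge_nonneg hc,
    ← setLIntegral_Ioi_ofReal_mul_exp_neg_mul_pow hc,
    ← lintegral_mul_const _ (by fun_prop)]
  refine setLIntegral_mono' measurableSet_Ioi fun t (ht : 0 < t) => ?_
  have hsub : {z | gauge K z < t} ⊆ t • K := fun z hz =>
    mem_smul_of_gauge_le hK hKc h0 ht (le_of_lt hz)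
  calc ENNReal.ofReal (c * Real.exp (-c * t)) * μ {z | gauge K z < t}
      ≤ ENNReal.ofReal (c * Real.exp (-c * t)) * μ (t • K) := by gcongr
    _ = _ := by
        rw [Measure.addHaar_smul_of_nonneg _ ht.le, ← mul_assoc,
          ← ENNReal.ofReal_mul (by positivity)]

theorem factorial_le_exp_mul_sqrt_mul {n : ℕ} (hn : n ≠ 0) :
    (n.factorial : ℝ) ≤ Real.exp 1 * √n * (n / Real.exp 1) ^ n := by
  obtain ⟨k, rfl⟩ := Nat.exists_eq_succ_of_ne_zero hn
  have h := Stirling.stirlingSeq'_antitone (Nat.zero_le k)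
  simp only [Function.comp_apply, Nat.succ_eq_add_one, zero_add, Stirling.stirlingSeq_one] at h
  rw [Stirling.stirlingSeq, div_le_iff₀ (by positivity), Real.sqrt_mul zero_le_two] at h
  refine h.trans_eq ?_
  field_simp

end ExponentialIntegrals

section MidpointLaw

open scoped ENNReal

theorem prod_self_eq_lintegral_add_sub {E : Type*} [NormedAddCommGroup E] [NormedSpace ℝ E]
    [FiniteDimensional ℝ E] [MeasurableSpace E] [BorelSpace E] (μ : Measure E)
    [μ.IsAddHaarMeasure] {S : Set (E × E)} (hS : MeasurableSet S) :
    (μ.prod μ) S = 2 ^ Module.finrank ℝ E * ∫⁻ z, μ {w | (w + z, z - w) ∈ S} ∂μ := by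
  have hslice (x : E) : μ {y | (x, y) ∈ S} =
      2 ^ Module.finrank ℝ E * μ {z | (x, (2 : ℝ) • z - x) ∈ S} := by
    have hscale := Measure.addHaar_preimage_smul μ (two_ne_zero (α := ℝ)) ({y | (x, y - x) ∈ S})
    have hshift : μ {y | (x, y - x) ∈ S} = μ {y | (x, y) ∈ S} := by
      simp only [sub_eq_add_neg]
      exact measure_preimage_add_right μ (-x) {y | (x, y) ∈ S}
    have habs : ENNReal.ofReal |((2 : ℝ) ^ Module.finrank ℝ E)⁻¹| =
        (2 ^ Module.finrank ℝ E)⁻¹ := by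
      rw [abs_of_pos (by positivity), ENNReal.ofReal_inv_of_pos (by positivity),
        ENNReal.ofReal_pow zero_le_two, ENNReal.ofReal_ofNat]
    rw [hshift, habs] at hscale
    change μ {z | (x, (2 : ℝ) • z - x) ∈ S} = _ at hscale
    rw [hscale, ← mul_assoc, ENNReal.mul_inv_cancel (by simp) (by simp), one_mul]
  have hshear : Measurable fun p : E × E => (p.1, (2 : ℝ) • p.2 - p.1) := by fun_prop
  calc (μ.prod μ) S = ∫⁻ x, 2 ^ Module.finrank ℝ E * μ {z | (x, (2 : ℝ) • z - x) ∈ S} ∂μ := by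
        rw [Measure.prod_apply hS]
        exact lintegral_congr hslice
    _ = 2 ^ Module.finrank ℝ E * (μ.prod μ) ((fun p => (p.1, (2 : ℝ) • p.2 - p.1)) ⁻¹' S) := by
        rw [lintegral_const_mul' _ _ (by simp), Measure.prod_apply (hshear hS)]
        rfl
    _ = 2 ^ Module.finrank ℝ E * ∫⁻ z, μ {w | (w + z, z - w) ∈ S} ∂μ := by
        rw [Measure.prod_apply_symm (hshear hS)]
        congr 2 with z
        rw [← measure_preimage_add_right μ z]
        congr 1 with w
        simp only [mem_preimage, mem_ofPred_eq, two_smul, add_sub_add_right_eq_sub]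

variable {n : ℕ} {K : Set (EuclideanSpace ℝ (Fin n))}

/-- The joint law of two independent uniformly distributed points of `K`. -/
noncomputable def uniformPair (K : Set (EuclideanSpace ℝ (Fin n))) :
    Measure (EuclideanSpace ℝ (Fin n) × EuclideanSpace ℝ (Fin n)) :=
  (ProbabilityTheory.cond volume K).prod (ProbabilityTheory.cond volume K)

/-- The law of the midpoint of two independent uniformly distributed points of `K`. -/
noncomputable def midpointLaw (K : Set (EuclideanSpace ℝ (Fin n))) :
    Measure (EuclideanSpace ℝ (Fin n)) :=
  (uniformPair K).map fun p => (1 / 2 : ℝ) • (p.1 + p.2)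

theorem IsConvexBody.volume_ne_zero (hK : IsConvexBody K) : volume K ≠ 0 :=
  (Measure.measure_pos_of_nonempty_interior _ hK.interior_nonempty).ne'

theorem IsConvexBody.volume_ne_top (hK : IsConvexBody K) : volume K ≠ ∞ :=
  hK.isCompact.measure_lt_top.ne

theorem IsConvexBody.volume_real_pos (hK : IsConvexBody K) : 0 < volume.real K :=
  ENNReal.toReal_pos hK.volume_ne_zero hK.volume_ne_top

theorem IsConvexBody.isProbabilityMeasure_cond (hK : IsConvexBody K) :
    IsProbabilityMeasure (ProbabilityTheory.cond volume K) :=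
  ProbabilityTheory.cond_isProbabilityMeasure_of_finite hK.volume_ne_zero hK.volume_ne_top

theorem IsConvexBody.isProbabilityMeasure_uniformPair (hK : IsConvexBody K) :
    IsProbabilityMeasure (uniformPair K) :=
  have := hK.isProbabilityMeasure_cond
  inferInstanceAs (IsProbabilityMeasure (Measure.prod _ _))

theorem uniformPair_eq_smul_restrict (K : Set (EuclideanSpace ℝ (Fin n))) :
    uniformPair K = (volume K)⁻¹ ^ 2 • (volume.prod volume).restrict (K ×ˢ K) := by
  rw [uniformPair, ProbabilityTheory.cond, Measure.prod_smul_left, Measure.prod_smul_right,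
    smul_smul, Measure.prod_restrict, sq]

theorem IsConvexBody.uniformPair_apply (hK : IsConvexBody K)
    (S : Set (EuclideanSpace ℝ (Fin n) × EuclideanSpace ℝ (Fin n))) :
    uniformPair K S = (volume K)⁻¹ ^ 2 * (volume.prod volume) (S ∩ K ×ˢ K) := by
  have hKm := hK.isCompact.measurableSet
  rw [uniformPair_eq_smul_restrict, Measure.smul_apply, smul_eq_mul,
    Measure.restrict_apply' (hKm.prod hKm)]

theorem IsConvexBody.ae_uniformPair_mem (hK : IsConvexBody K) :
    ∀ᵐ p ∂uniformPair K, p ∈ K ×ˢ K := by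
  have hKm := hK.isCompact.measurableSet
  rw [uniformPair_eq_smul_restrict]
  exact Measure.ae_smul_measure (ae_restrict_mem (hKm.prod hKm)) _

theorem IsConvexBody.integrable_uniformPair (hK : IsConvexBody K)
    {F : EuclideanSpace ℝ (Fin n) × EuclideanSpace ℝ (Fin n) → ℝ} (hF : Continuous F) :
    Integrable F (uniformPair K) := by
  rw [uniformPair_eq_smul_restrict]
  exact (hF.continuousOn.integrableOn_compact (hK.isCompact.prod hK.isCompact)).smul_measure
    (by simpa using hK.volume_ne_zero)

theorem continuous_half_smul_add :
    Continuous fun p : EuclideanSpace ℝ (Fin n) × EuclideanSpace ℝ (Fin n) =>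
      (1 / 2 : ℝ) • (p.1 + p.2) := by
  fun_prop

theorem IsConvexBody.isProbabilityMeasure_midpointLaw (hK : IsConvexBody K) :
    IsProbabilityMeasure (midpointLaw K) :=
  have := hK.isProbabilityMeasure_uniformPair
  Measure.isProbabilityMeasure_map continuous_half_smul_add.aemeasurable

theorem IsConvexBody.integrable_midpointLaw (hK : IsConvexBody K)
    {g : EuclideanSpace ℝ (Fin n) → ℝ} (hg : Continuous g) : Integrable g (midpointLaw K) :=
  (integrable_map_measure hg.aestronglyMeasurable continuous_half_smul_add.aemeasurable).2
    (hK.integrable_uniformPair (hg.comp continuous_half_smul_add))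

theorem integral_midpointLaw {g : EuclideanSpace ℝ (Fin n) → ℝ} (hg : Continuous g) :
    ∫ z, g z ∂midpointLaw K = ∫ p, g ((1 / 2 : ℝ) • (p.1 + p.2)) ∂uniformPair K :=
  integral_map continuous_half_smul_add.aemeasurable hg.aestronglyMeasurable

theorem IsConvexBody.integral_clm_midpointLaw (hK : IsConvexBody K)
    (ℓ : EuclideanSpace ℝ (Fin n) →L[ℝ] ℝ) :
    ∫ z, ℓ z ∂midpointLaw K = ℓ (barycenter K) := by
  have hprob := hK.isProbabilityMeasure_cond
  have hbary : barycenter K = ∫ x, x ∂ProbabilityTheory.cond volume K := by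
    rw [barycenter, average, Measure.restrict_apply_univ, ProbabilityTheory.cond]
  have hinteg : Integrable (fun x => x) (ProbabilityTheory.cond volume K) :=
    (continuous_id.continuousOn.integrableOn_compact hK.isCompact).smul_measure
      (ENNReal.inv_ne_top.2 hK.volume_ne_zero)
  have hcoord : ∫ x, ℓ x ∂ProbabilityTheory.cond volume K = ℓ (barycenter K) := by
    rw [ℓ.integral_comp_comm hinteg, hbary]
  have hfst := hK.integrable_uniformPair (ℓ.continuous.comp continuous_fst)
  have hsnd := hK.integrable_uniformPair (ℓ.continuous.comp continuous_snd)
  simp only [Function.comp_def] at hfst hsnd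
  rw [integral_midpointLaw ℓ.continuous]
  simp only [map_smul, map_add, smul_eq_mul]
  rw [integral_const_mul, integral_add hfst hsnd, uniformPair, integral_fun_fst (fun x => ℓ x),
    integral_fun_snd (fun x => ℓ x), hcoord, probReal_univ, one_smul]
  ring

end MidpointLaw

section SymmetricIntersection

open scoped ENNReal

variable {n : ℕ} {K : Set (EuclideanSpace ℝ (Fin n))}

theorem isCompact_symmInter (hK : IsCompact K) (z : EuclideanSpace ℝ (Fin n)) :
    IsCompact ((K - {z}) ∩ ({z} - K)) := by
  simp only [sub_eq_add_neg]
  exact (hK.add isCompact_singleton.neg).inter (isCompact_singleton.add hK.neg)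

theorem symmRatio_zero (K : Set (EuclideanSpace ℝ (Fin n))) :
    symmRatio K 0 = volume.real (K ∩ -K) / volume.real K := by
  have hset : (K - {0}) ∩ ({0} - K) = K ∩ -K := Set.ext fun x => by
    rw [mem_symmInter, add_zero, zero_sub, mem_inter_iff, Set.mem_neg]
  rw [symmRatio, hset]

theorem IsConvexBody.symmRatio_le_kovnerBesicovitch (hK : IsConvexBody K)
    (z : EuclideanSpace ℝ (Fin n)) : symmRatio K z ≤ kovnerBesicovitch K :=
  hK.isGreatest_kovnerBesicovitch.2 (mem_range_self z)

theorem measurable_symmRatio (hK : MeasurableSet K) : Measurable (symmRatio K) := by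
  have hS : MeasurableSet {p : EuclideanSpace ℝ (Fin n) × EuclideanSpace ℝ (Fin n) |
      p.2 + p.1 ∈ K ∧ p.1 - p.2 ∈ K} :=
    (measurableSet_preimage (by fun_prop) hK).inter (measurableSet_preimage (by fun_prop) hK)
  have hratio : symmRatio K = fun z => (volume (Prod.mk z ⁻¹' {p : EuclideanSpace ℝ (Fin n) ×
      EuclideanSpace ℝ (Fin n) | p.2 + p.1 ∈ K ∧ p.1 - p.2 ∈ K})).toReal / volume.real K := by
    funext z
    rw [symmRatio, measureReal_def]
    congr 3
    exact Set.ext fun w => mem_symmInter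
  rw [hratio]
  exact (measurable_measure_prodMk_left hS).ennreal_toReal.div_const _

theorem IsConvexBody.symmRatio_pos (hK : IsConvexBody K) {z : EuclideanSpace ℝ (Fin n)}
    (hz : K ∈ 𝓝 z) : 0 < symmRatio K z := by
  have hadd : Filter.Tendsto (fun u => u + z) (𝓝 0) (𝓝 z) :=
    Continuous.tendsto' (by fun_prop) _ _ (zero_add z)
  have hsub : Filter.Tendsto (fun u => z - u) (𝓝 0) (𝓝 z) :=
    Continuous.tendsto' (by fun_prop) _ _ (sub_zero z)
  have hnhds : (K - {z}) ∩ ({z} - K) ∈ 𝓝 0 := by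
    filter_upwards [hadd hz, hsub hz] with u hu₁ hu₂ using mem_symmInter.2 ⟨hu₁, hu₂⟩
  exact div_pos (ENNReal.toReal_pos (Measure.measure_pos_of_mem_nhds _ hnhds).ne'
    (isCompact_symmInter hK.isCompact z).measure_lt_top.ne) hK.volume_real_pos

theorem IsConvexBody.isLogConcave_symmRatio (hK : IsConvexBody K) :
    IsLogConcave (symmRatio K) := by
  refine ⟨fun z => div_nonneg measureReal_nonneg measureReal_nonneg, fun x y a b ha hb hab => ?_⟩
  have hm (z : EuclideanSpace ℝ (Fin n)) : MeasurableSet ((K - {z}) ∩ ({z} - K)) :=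
    (isCompact_symmInter hK.isCompact z).measurableSet
  have hvol := (hasPrekopaLeindler_euclideanSpace ha hb hab n).volume_rpow_mul_rpow_le ha hb
    (hm x) (hm y) (hm (a • x + b • y)) fun u hu w hw => by
      rw [mem_symmInter] at hu hw ⊢
      constructor
      · convert hK.convex hu.1 hw.1 ha.le hb.le hab using 1
        module
      · convert hK.convex hu.2 hw.2 ha.le hb.le hab using 1
        module
  have hreal := ENNReal.toReal_mono
    (isCompact_symmInter hK.isCompact (a • x + b • y)).measure_lt_top.ne hvol
  rw [ENNReal.toReal_mul, ← ENNReal.toReal_rpow, ← ENNReal.toReal_rpow] at hreal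
  have hv := hK.volume_real_pos
  simp only [symmRatio]
  rw [Real.div_rpow measureReal_nonneg hv.le, Real.div_rpow measureReal_nonneg hv.le,
    div_mul_div_comm, ← Real.rpow_add hv, hab, Real.rpow_one]
  exact div_le_div_of_nonneg_right hreal hv.le

theorem IsConvexBody.ofReal_two_pow_div_mul_symmRatio (hK : IsConvexBody K)
    (z : EuclideanSpace ℝ (Fin n)) :
    ENNReal.ofReal (2 ^ n / volume.real K * symmRatio K z) =
      (volume K)⁻¹ ^ 2 * 2 ^ n * volume ((K - {z}) ∩ ({z} - K)) := by
  have hv := hK.volume_real_pos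
  have htwo : (2 : ℝ≥0∞) ^ n = ENNReal.ofReal (2 ^ n) := by
    rw [ENNReal.ofReal_pow zero_le_two, ENNReal.ofReal_ofNat]
  rw [symmRatio, ← ofReal_measureReal hK.volume_ne_top, ← ofReal_measureReal
    (isCompact_symmInter hK.isCompact z).measure_lt_top.ne, ← ENNReal.ofReal_inv_of_pos hv,
    htwo, ← ENNReal.ofReal_pow (by positivity), ← ENNReal.ofReal_mul (by positivity),
    ← ENNReal.ofReal_mul (by positivity)]
  congr 1
  field_simp

theorem IsConvexBody.midpointLaw_eq_withDensity (hK : IsConvexBody K) :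
    midpointLaw K =
      volume.withDensity fun z => ENNReal.ofReal (2 ^ n / volume.real K * symmRatio K z) := by
  have hKm := hK.isCompact.measurableSet
  refine Measure.ext fun A hA => ?_
  have hslice (z : EuclideanSpace ℝ (Fin n)) :
      volume {w | (w + z, z - w) ∈ (fun p => (1 / 2 : ℝ) • (p.1 + p.2)) ⁻¹' A ∩ K ×ˢ K} =
        A.indicator (fun z => volume ((K - {z}) ∩ ({z} - K))) z := by
    have hmid (w : EuclideanSpace ℝ (Fin n)) : (1 / 2 : ℝ) • (w + z + (z - w)) = z := by module
    by_cases hz : z ∈ A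
    · rw [indicator_of_mem hz]
      congr 1 with w
      rw [mem_symmInter]
      simp only [mem_ofPred_eq, mem_inter_iff, mem_preimage, hmid, hz, true_and, mem_prod]
    · simp only [mem_inter_iff, mem_preimage, hmid, hz, false_and, ofPred_false, measure_empty,
        not_false_eq_true, indicator_of_notMem]
  have hmid := (continuous_half_smul_add (n := n)).measurable
  rw [midpointLaw, Measure.map_apply hmid hA, hK.uniformPair_apply,
    prod_self_eq_lintegral_add_sub volume ((hmid hA).inter (hKm.prod hKm)),
    finrank_euclideanSpace_fin, withDensity_apply _ hA]
  have hfin : (volume K)⁻¹ ^ 2 * (2 : ℝ≥0∞) ^ n ≠ ∞ := ENNReal.mul_ne_top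
    (ENNReal.pow_ne_top (ENNReal.inv_ne_top.2 hK.volume_ne_zero)) (by finiteness)
  simp only [hslice, hK.ofReal_two_pow_div_mul_symmRatio]
  rw [lintegral_indicator hA, lintegral_const_mul' _ _ hfin, mul_assoc]

end SymmetricIntersection

section UniformConvexity

variable {n : ℕ} {K : Set (EuclideanSpace ℝ (Fin n))} {r ε : ℝ}

theorem IsConvexBody.barycenter_mem_interior (hK : IsConvexBody K) :
    barycenter K ∈ interior K := by
  have : IsFiniteMeasure (volume.restrict K) := isFiniteMeasure_restrict.2 hK.volume_ne_top
  have hinteg : IntegrableOn (fun x : EuclideanSpace ℝ (Fin n) => x) K :=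
    continuousOn_id.integrableOn_compact hK.isCompact
  obtain ⟨c, hc⟩ := hK.interior_nonempty
  obtain ⟨ρ, hρ, hsub⟩ := Metric.nhds_basis_closedBall.mem_iff.1 (isOpen_interior.mem_nhds hc)
  have hball : (volume.restrict K) (Metric.closedBall c ρ) ≠ 0 := by
    rw [Measure.restrict_apply Metric.isClosed_closedBall.measurableSet,
      inter_eq_left.2 (hsub.trans interior_subset)]
    exact (Metric.measure_closedBall_pos _ _ hρ).ne'
  refine hK.convex.average_mem_interior_of_set hball
    (ae_restrict_mem hK.isCompact.measurableSet) hinteg (hsub ?_)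
  exact (convex_closedBall c ρ).set_average_mem Metric.isClosed_closedBall hball
    (measure_ne_top _ _) (ae_restrict_mem Metric.isClosed_closedBall.measurableSet)
    hinteg.integrable.integrableOn

theorem IsConvexBody.mem_nhds_zero (hK : IsConvexBody K) (hbary : barycenter K = 0) :
    K ∈ 𝓝 0 :=
  mem_interior_iff_mem_nhds.1 (hbary ▸ hK.barycenter_mem_interior)

theorem gauge_midpoint_le_one {E : Type*} [AddCommGroup E] [Module ℝ E] {K : Set E}
    (hK : Convex ℝ K) (habs : Absorbent ℝ K) {x y : E} (hx : gauge K x ≤ 1)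
    (hy : gauge K y ≤ 1) : gauge K ((1 / 2 : ℝ) • (x + y)) ≤ 1 := by
  rw [gauge_smul_of_nonneg (by positivity), smul_eq_mul]
  linarith [gauge_add_le hK habs x y]

theorem gauge_midpoint_le_of_le_modulusOfConvexity (hK : Convex ℝ K) (habs : Absorbent ℝ K)
    (hδ : r ≤ modulusOfConvexity K ε) {x y : EuclideanSpace ℝ (Fin n)} (hx : gauge K x ≤ 1)
    (hy : gauge K y ≤ 1) (hxy : ε ≤ gauge K (x - y)) :
    gauge K ((1 / 2 : ℝ) • (x + y)) ≤ 1 - r := by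
  have hbdd : BddBelow {d : ℝ | ∃ x y : EuclideanSpace ℝ (Fin n), gauge K x ≤ 1 ∧
      gauge K y ≤ 1 ∧ ε ≤ gauge K (x - y) ∧ d = 1 - gauge K ((1 / 2 : ℝ) • (x + y))} := by
    refine ⟨0, ?_⟩
    rintro _ ⟨x, y, hx, hy, -, rfl⟩
    exact sub_nonneg.2 (gauge_midpoint_le_one hK habs hx hy)
  exact le_sub_comm.1 (hδ.trans (csInf_le hbdd ⟨x, y, hx, hy, hxy, rfl⟩))

/-- The pairs of points at `K`-distance at least `ε`, whose midpoints uniform convexity controls. -/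
def farPairs (K : Set (EuclideanSpace ℝ (Fin n))) (ε : ℝ) :
    Set (EuclideanSpace ℝ (Fin n) × EuclideanSpace ℝ (Fin n)) :=
  {p | ε ≤ gauge K (p.1 - p.2)}

theorem IsConvexBody.measurableSet_farPairs (hK : IsConvexBody K) (h0 : K ∈ 𝓝 0) (ε : ℝ) :
    MeasurableSet (farPairs K ε) :=
  measurableSet_le measurable_const
    ((continuous_gauge hK.convex h0).comp (by fun_prop)).measurable

theorem IsConvexBody.one_sub_exp_le_uniformPair_farPairs (hK : IsConvexBody K) (h0 : K ∈ 𝓝 0)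
    (hε₀ : 0 < ε) (hε₁ : ε < √2) :
    1 - Real.exp (-((√2 - ε) ^ 2 / 4 * n)) ≤ (uniformPair K).real (farPairs K ε) := by
  have hprob := hK.isProbabilityMeasure_uniformPair
  have hv := hK.volume_ne_zero
  have hsub : (farPairs K ε)ᶜ ∩ K ×ˢ K ⊆ subTriple K K (ε • K) := fun p ⟨hp, hp₁, hp₂⟩ =>
    have hnear : ¬ε ≤ gauge K (p.1 - p.2) := hp
    ⟨hp₁, hp₂, mem_smul_of_gauge_le hK.convex hK.isCompact.isClosed h0 hε₀ (le_of_not_ge hnear)⟩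
  have hnear : uniformPair K (farPairs K ε)ᶜ ≤
      ENNReal.ofReal (Real.exp (-((√2 - ε) ^ 2 / 4 * n))) := by
    calc uniformPair K (farPairs K ε)ᶜ
        = (volume K)⁻¹ ^ 2 * (volume.prod volume) ((farPairs K ε)ᶜ ∩ K ×ˢ K) :=
          hK.uniformPair_apply _
      _ ≤ (volume K)⁻¹ ^ 2 *
          (ENNReal.ofReal (Real.exp (-((√2 - ε) ^ 2 / 4 * n))) * volume K ^ 2) := by
          gcongr
          exact (measure_mono hsub).trans
            (volume_subTriple_smul_le_exp hK.isCompact.measurableSet hε₀ hε₁)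
      _ = ENNReal.ofReal (Real.exp (-((√2 - ε) ^ 2 / 4 * n))) := by
          rw [mul_left_comm, ← mul_pow, ENNReal.inv_mul_cancel hv hK.volume_ne_top, one_pow,
            mul_one]
  have hreal := ENNReal.toReal_le_of_le_ofReal (Real.exp_nonneg _) hnear
  rw [← measureReal_def, probReal_compl_eq_one_sub (hK.measurableSet_farPairs h0 ε)] at hreal
  linarith

theorem IsConvexBody.midpointLaw_le (hK : IsConvexBody K) (A : Set (EuclideanSpace ℝ (Fin n))) :
    midpointLaw K A ≤
      ENNReal.ofReal (2 ^ n / volume.real K * kovnerBesicovitch K) * volume A := by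
  rw [hK.midpointLaw_eq_withDensity, withDensity_apply' _ A, ← setLIntegral_const]
  gcongr with z
  exact hK.symmRatio_le_kovnerBesicovitch z

theorem IsConvexBody.uniformPair_farPairs_le (hK : IsConvexBody K) (h0 : K ∈ 𝓝 0) (hr₁ : r < 1)
    (hδ : r ≤ modulusOfConvexity K ε) :
    (uniformPair K).real (farPairs K ε) ≤ (2 * (1 - r)) ^ n * kovnerBesicovitch K := by
  have hv := hK.volume_real_pos
  have hr : 0 < 1 - r := sub_pos.2 hr₁
  have hkb : 0 ≤ kovnerBesicovitch K :=
    (hK.symmRatio_pos h0).le.trans (hK.symmRatio_le_kovnerBesicovitch 0)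
  have hmid : ∀ᵐ p ∂uniformPair K, p ∈ farPairs K ε →
      p ∈ (fun p => (1 / 2 : ℝ) • (p.1 + p.2)) ⁻¹' ((1 - r) • K) := by
    filter_upwards [hK.ae_uniformPair_mem] with p hp hfar
    exact mem_smul_of_gauge_le hK.convex hK.isCompact.isClosed h0 hr
      (gauge_midpoint_le_of_le_modulusOfConvexity hK.convex (absorbent_nhds_zero h0) hδ
        (gauge_le_one_of_mem hp.1) (gauge_le_one_of_mem hp.2) hfar)
  have hvol : volume ((1 - r) • K) = ENNReal.ofReal ((1 - r) ^ n * volume.real K) := by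
    rw [Measure.addHaar_smul_of_nonneg _ hr.le, finrank_euclideanSpace_fin,
      ENNReal.ofReal_mul (by positivity), ofReal_measureReal hK.volume_ne_top]
  refine ENNReal.toReal_le_of_le_ofReal (by positivity) ?_
  calc uniformPair K (farPairs K ε)
      ≤ uniformPair K ((fun p => (1 / 2 : ℝ) • (p.1 + p.2)) ⁻¹' ((1 - r) • K)) :=
        measure_mono_ae hmid
    _ ≤ midpointLaw K ((1 - r) • K) :=
        Measure.le_map_apply continuous_half_smul_add.aemeasurable _
    _ ≤ ENNReal.ofReal (2 ^ n / volume.real K * kovnerBesicovitch K) * volume ((1 - r) • K) :=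
        hK.midpointLaw_le _
    _ = ENNReal.ofReal ((2 * (1 - r)) ^ n * kovnerBesicovitch K) := by
        rw [hvol, ← ENNReal.ofReal_mul (by positivity)]
        congr 1
        rw [mul_pow]
        field_simp

theorem IsConvexBody.integral_gauge_midpointLaw_le (hK : IsConvexBody K) (h0 : K ∈ 𝓝 0)
    (hδ : r ≤ modulusOfConvexity K ε) :
    ∫ z, gauge K z ∂midpointLaw K ≤ 1 - (uniformPair K).real (farPairs K ε) * r := by
  have hprob := hK.isProbabilityMeasure_uniformPair
  have hfar := hK.measurableSet_farPairs h0 ε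
  have hgauge := continuous_gauge hK.convex h0
  have habs := absorbent_nhds_zero (𝕜 := ℝ) h0
  have hinteg : Integrable ((farPairs K ε).indicator fun _ => r) (uniformPair K) :=
    (integrable_const r).indicator hfar
  calc ∫ z, gauge K z ∂midpointLaw K
      = ∫ p, gauge K ((1 / 2 : ℝ) • (p.1 + p.2)) ∂uniformPair K := integral_midpointLaw hgauge
    _ ≤ ∫ p, (1 - (farPairs K ε).indicator (fun _ => r) p) ∂uniformPair K := by
        refine integral_mono_ae
          (hK.integrable_uniformPair (hgauge.comp continuous_half_smul_add))
          ((integrable_const 1).sub hinteg) ?_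
        filter_upwards [hK.ae_uniformPair_mem] with p hp
        have hp₁ := gauge_le_one_of_mem hp.1
        have hp₂ := gauge_le_one_of_mem hp.2
        by_cases hpfar : p ∈ farPairs K ε
        · rw [indicator_of_mem hpfar]
          exact gauge_midpoint_le_of_le_modulusOfConvexity hK.convex habs hδ hp₁ hp₂ hpfar
        · rw [indicator_of_notMem hpfar, sub_zero]
          exact gauge_midpoint_le_one hK.convex habs hp₁ hp₂
    _ = 1 - (uniformPair K).real (farPairs K ε) * r := by
        rw [integral_sub (integrable_const 1) hinteg, integral_indicator_const r hfar,
          integral_const, probReal_univ, one_smul, smul_eq_mul]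

theorem IsConvexBody.exp_neg_integral_gauge_le (hK : IsConvexBody K) (hbary : barycenter K = 0)
    {c : ℝ} (hc : 0 < c) :
    Real.exp (-(c * ∫ z, gauge K z ∂midpointLaw K)) ≤
      2 ^ n * (n.factorial / c ^ n) * symmRatio K 0 := by
  have h0 := hK.mem_nhds_zero hbary
  have hgauge : Continuous fun z => c * gauge K z :=
    continuous_const.mul (continuous_gauge hK.convex h0)
  have hpos : ∀ᶠ z in 𝓝 0, 0 < symmRatio K z := by
    filter_upwards [eventually_mem_nhds_iff.2 h0] with z hz using hK.symmRatio_pos hz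
  obtain ⟨ℓ, hℓ⟩ := hK.isLogConcave_symmRatio.exists_le_mul_exp hpos
  have hv := hK.volume_real_pos
  have hs := hpos.self_of_nhds
  have hlaw := hK.midpointLaw_eq_withDensity
  have hprob := hK.isProbabilityMeasure_midpointLaw
  have hmean := hK.integral_clm_midpointLaw ℓ
  have hℓint := hK.integrable_midpointLaw ℓ.continuous
  have hgint := hK.integrable_midpointLaw hgauge
  rw [hbary, map_zero] at hmean
  rw [hlaw] at hprob hmean hℓint hgint
  have hgibbs := ofReal_exp_neg_integral_le
    (D := ENNReal.ofReal (2 ^ n / volume.real K * symmRatio K 0))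
    ((measurable_symmRatio hK.isCompact.measurableSet).const_mul _).ennreal_ofReal
    ℓ.measurable hgauge.measurable hℓint hgint (fun z => by
      rw [← ENNReal.ofReal_mul (by positivity), mul_assoc]
      gcongr
      simpa only [sub_zero] using hℓ z) hmean
  rw [← hlaw, integral_const_mul] at hgibbs
  refine (ENNReal.ofReal_le_ofReal_iff (by positivity)).1 ?_
  calc ENNReal.ofReal (Real.exp (-(c * ∫ z, gauge K z ∂midpointLaw K)))
      ≤ ENNReal.ofReal (2 ^ n / volume.real K * symmRatio K 0) *
          ∫⁻ z, ENNReal.ofReal (Real.exp (-(c * gauge K z))) := hgibbs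
    _ ≤ ENNReal.ofReal (2 ^ n / volume.real K * symmRatio K 0) *
          (ENNReal.ofReal (n.factorial / c ^ n) * volume K) := by
        gcongr
        simpa only [finrank_euclideanSpace_fin] using
          lintegral_exp_neg_gauge_le hK.convex hK.isCompact.isClosed h0 hc
    _ = ENNReal.ofReal (2 ^ n * (n.factorial / c ^ n) * symmRatio K 0) := by
        rw [← ofReal_measureReal hK.volume_ne_top, ← ENNReal.ofReal_mul (by positivity),
          ← ENNReal.ofReal_mul (by positivity)]
        congr 1
        field_simp

theorem IsConvexBody.one_le_mul_symmRatio_zero (hK : IsConvexBody K) (hbary : barycenter K = 0)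
    (hn : n ≠ 0) {m : ℝ} (hm : 0 < m) (hgauge : ∫ z, gauge K z ∂midpointLaw K ≤ m) :
    1 ≤ Real.exp 1 * √n * (2 * m) ^ n * symmRatio K 0 := by
  have hn0 : (0 : ℝ) < n := by positivity
  have hs := hK.symmRatio_pos (hK.mem_nhds_zero hbary)
  have hexp : Real.exp (-n) ≤ 2 ^ n * (n.factorial / (n / m) ^ n) * symmRatio K 0 := by
    refine le_trans (Real.exp_le_exp.2 (neg_le_neg ?_))
      (hK.exp_neg_integral_gauge_le hbary (div_pos hn0 hm))
    calc n / m * ∫ z, gauge K z ∂midpointLaw K ≤ n / m * m := by gcongr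
      _ = n := div_mul_cancel₀ _ hm.ne'
  calc (1 : ℝ) = Real.exp n * Real.exp (-n) := by rw [← Real.exp_add, add_neg_cancel, Real.exp_zero]
    _ ≤ Real.exp n * (2 ^ n *
          (Real.exp 1 * √n * (n / Real.exp 1) ^ n / (n / m) ^ n) * symmRatio K 0) := by
        grw [hexp, factorial_le_exp_mul_sqrt_mul hn]
    _ = Real.exp 1 * √n * (2 * m) ^ n * symmRatio K 0 := by
        rw [← mul_one (n : ℝ), Real.exp_nat_mul, mul_one, div_pow, div_pow, mul_pow]
        field_simp

theorem two_zpow_neg_mul_one_div_pow (x : ℝ) (n : ℕ) :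
    (2 : ℝ) ^ (-(n : ℤ)) * (1 / x) ^ n = ((2 * x) ^ n)⁻¹ := by
  rw [zpow_neg, zpow_natCast, one_div, inv_pow, ← mul_inv, mul_pow]

end UniformConvexity

theorem theorem1p5 (n : ℕ) (r ε α : ℝ) (hr₀ : 0 < r) (hr₁ : r < 1) (hε₀ : 0 < ε)
    (hε₁ : ε < Real.sqrt 2)
    (hα : α = 1 - Real.exp (-((Real.sqrt 2 - ε) ^ 2 / 4 * (n : ℝ))))
    (K : Set (EuclideanSpace ℝ (Fin n))) (hK : IsConvexBody K) (hcentered : barycenter K = 0)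
    (hδ : r ≤ modulusOfConvexity K ε) :
    kovnerBesicovitch K ≥ α * (2 : ℝ) ^ (-(n : ℤ)) * (1 / (1 - r)) ^ n ∧
      volume.real (K ∩ (-K)) / volume.real K ≥
        1 / (Real.exp 1 * Real.sqrt n) * (2 : ℝ) ^ (-(n : ℤ)) * (1 / (1 - α * r)) ^ n := by
  have h0 : K ∈ 𝓝 0 := hK.mem_nhds_zero hcentered
  have hr : 0 < 1 - r := sub_pos.2 hr₁
  have hfar : α ≤ (uniformPair K).real (farPairs K ε) :=
    hα ▸ hK.one_sub_exp_le_uniformPair_farPairs h0 hε₀ hε₁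
  have hm : 0 < 1 - α * r := by
    have hα₁ : α < 1 := hα ▸ sub_lt_self 1 (Real.exp_pos _)
    linarith [mul_lt_mul_of_pos_right hα₁ hr₀]
  rw [ge_iff_le, ge_iff_le, mul_assoc, mul_assoc, two_zpow_neg_mul_one_div_pow,
    two_zpow_neg_mul_one_div_pow, ← symmRatio_zero]
  constructor
  · rw [← div_eq_mul_inv, div_le_iff₀' (pow_pos (mul_pos two_pos hr) n)]
    exact hfar.trans (hK.uniformPair_farPairs_le h0 hr₁ hδ)
  · rcases eq_or_ne n 0 with rfl | hn
    · simpa using (hK.symmRatio_pos h0).le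
    have hgauge : ∫ z, gauge K z ∂midpointLaw K ≤ 1 - α * r :=
      (hK.integral_gauge_midpointLaw_le h0 hδ).trans (by gcongr)
    rw [← div_eq_mul_inv, div_div, div_le_iff₀' (by positivity)]
    exact hK.one_le_mul_symmRatio_zero hcentered hn hm hgauge
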